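/- Conventions. Let $G$ be a finitely generated commutative monoid with a homomorphism $\omega:G\to\mathbb R_{\ge 0}$ such that $\omega(\beta)=0$ only for $\beta=0$. A \emph{$G$-gapped filtered $A_\infty$ algebra} $B$ is given by a $\mathbb Z$-graded complex vector space $\underline B$ and $\mathbb C$-multilinear operations $m^{k,\beta}:\underline B^{\otimes k}\to\underline B$ of degree $2-k$ ($k\ge 0$, $\beta\in G$), with $m^{0,0}=0$, satisfying the gapped $A_\infty$ relations $$\sum_{\beta_1+\beta_2=\beta}\ \sum_{k_1+k'+k_2=k}(-1)^{\clubsuit}\,m^{k_1+1+k_2,\beta_1}\circ(\mathrm{id}^{\otimes k_1}\otimes m^{k',\beta_2}\otimes \mathrm{id}^{\otimes k_2})(x_1,\dots,x_k)=0,\qquad \clubsuit=k_1+\sum_{j\le k_1}\deg x_j ;$$ the underlying filtered algebra is the completed free module $\underline B\,\hat\otimes\,\Lambda_{\ge 0}$ over the Novikov ring with $m^k=\sum_\beta T^{\omega(\beta)}m^{k,\beta}$. The space $\underline B$ is a cochain complex with differential $m^{1,0}$. A \emph{deforming cochain} is $b=\sum_{\beta\in G\setminus\{0\}}T^{\omega(\beta)}b_\beta$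 with $b_\beta\in\underline B^1$; the curvature of the deformed algebra $(B,b)$ has components $$m^{0,\beta}_{(B,b)}=\sum_{l\ge 0}\ \sum_{\beta_0+\beta_1+\dots+\beta_l=\beta}m^{l,\beta_0}(b_{\beta_1}\otimes\cdots\otimes b_{\beta_l}),$$ and $b$ is a \emph{bounding cochain} if all of these vanish. A \emph{strong $A_\infty$ ideal} $A$ of $B$ is a graded subspace $\underline A\subset\underline B$ which contains all $m^{0,\beta}$ and all values $m^{k,\beta}(x_1,\dots,x_k)$ with $k>0$ and at least one $x_i\in\underline A$; then $A$ and $C=B/A$ are gapped $A_\infty$ algebras, and $0\to\underline A\to\underline B\to\underline C\to 0$ is a short exact sequence of cochain complexes. Homotopy equivalence means homotopy equivalence through $G$-gapped filtered $A_\infty$ homomorphisms. An \emph{anticommutative DGA} is a $G$-gapped $A_\infty$ algebra with $m^{k,\beta}=0$ for $k\ne 1,2$, with $m^{1,\beta}=0$ for $\beta\neq 0$ (the differential is the scalar extension of a $\mathbb C$-linear one), and with $m^{2,\beta}(x,y)=-(-1)^{(\deg x+1)(\deg y+1)}m^{2,\beta}(y,x)$ for homogeneous $x,y$. Statement. Let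 $B$ be a $G$-gapped filtered $A_\infty$ algebra, $A$ a strong $A_\infty$ ideal of $B$ and $C=B/A$. Suppose that $C$ is homotopy equivalent to an anticommutative DGA, and that the connecting map $\delta:H^1(\underline C)\to H^2(\underline A)$ is surjective. Then for every $\lambda>0$ there is a deforming cochain $b=\sum_{\beta\in G\setminus\{0\}}T^{\omega(\beta)}b_\beta$ for $B$ such that $m^{0,\beta}_{(B,b)}=0$ for all $\beta\in G$ with $\omega(\beta)\le\lambda$. Moreover, $B$ has a bounding cochain. -/

import Mathlib

open scoped NNReal
open CategoryTheory

universe u v w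

/-! ### Gapping monoids -/

/-- The monoids `G` used for gapped structures: a finitely generated commutative monoid together
with an energy homomorphism `ω : G → ℝ≥0` such that `ω β = 0` only for `β = 0`. -/
class GappingMonoid (G : Type v) extends AddCommMonoid G where
  energy : G →+ ℝ≥0
  fg : AddMonoid.FG G
  eq_zero_of_energy : ∀ β : G, energy β = 0 → β = 0

namespace GappingMonoid

variable {G : Type v} [GappingMonoid G]

theorem finite_energy_le (c : ℝ≥0) : {β : G | energy β ≤ c}.Finite := by
  classical
  obtain ⟨S, hS⟩ := (GappingMonoid.fg (G := G)).fg_top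
  have key : ∀ g : G, ∃ n : ℕ, g = 0 ∨ ∀ k : ℕ, k • energy g ≤ c → k ≤ n := by
    intro g
    by_cases hg : g = 0
    · exact ⟨0, Or.inl hg⟩
    · have hpos : 0 < energy g :=
        pos_iff_ne_zero.mpr fun h => hg (eq_zero_of_energy g h)
      obtain ⟨n, hn⟩ := exists_nat_gt (c / energy g)
      refine ⟨n, Or.inr fun k hk => ?_⟩
      have h1 : (k : ℝ≥0) ≤ c / energy g := by
        rw [le_div_iff₀ hpos, ← nsmul_eq_mul]
        exact hk
      exact_mod_cast (h1.trans hn.le)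
  choose N hN using key
  let T : Set (G → ℕ) := Set.pi Set.univ fun g => if g ∈ S then Set.Iic (N g) else {0}
  have hT : ((fun f : G → ℕ => ∑ g ∈ S, f g • g) '' T).Finite := by
    let M := ∑ g ∈ S, N g
    let U : Set (S → ℕ) := Set.Iic fun g => N g.1
    have hU : U.Finite := Set.finite_Iic _
    refine (hU.image fun f : S → ℕ => ∑ g : S, f g • g.1).subset ?_
    rintro _ ⟨f, hf, rfl⟩
    refine ⟨fun g => f g.1, fun g => ?_, ?_⟩
    · have := hf g.1 (Set.mem_univ _)
      simpa [g.2] using this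
    · exact Finset.sum_coe_sort S fun g => f g • g
  refine hT.subset ?_
  intro β hβ
  have hmem : β ∈ AddSubmonoid.closure (S : Set G) := by rw [hS]; trivial
  obtain ⟨f, -, hf⟩ := AddSubmonoid.mem_closure_finset.mp hmem
  refine ⟨fun g => if g ∈ S ∧ g ≠ 0 then f g else 0, ?_, ?_⟩
  · intro g _
    by_cases hg : g ∈ S
    · simp only [hg, if_true, true_and, Set.mem_Iic]
      by_cases h0 : g = 0
      · simp [h0]
      · simp only [ne_eq, h0, not_false_eq_true, if_true]
        refine (hN g).resolve_left h0 (f g) ?_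
        have h1 : energy (f g • g) ≤ energy β := by
          rw [← hf, map_sum]
          exact Finset.single_le_sum (f := fun a => energy (f a • a))
            (fun _ _ => zero_le) hg
        rw [map_nsmul] at h1
        exact h1.trans hβ
    · simp [hg]
  · rw [← hf]
    refine Finset.sum_congr rfl fun g hg => ?_
    by_cases h0 : g = 0
    · simp [h0]
    · simp [hg, h0]

theorem eq_zero_of_add_eq_zero {a b : G} (h : a + b = 0) : a = 0 ∧ b = 0 := by
  have h1 : energy a + energy b = 0 := by rw [← map_add, h, map_zero]
  rw [add_eq_zero] at h1
  exact ⟨eq_zero_of_energy a h1.1, eq_zero_of_energy b h1.2⟩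

/-- There are finitely many decompositions `β₁ + β₂ = β`, so that sums over them are finite. -/
noncomputable instance : Finset.HasAntidiagonal G where
  antidiagonal β := Set.Finite.toFinset (s := {q : G × G | q.1 + q.2 = β}) <| by
    refine ((finite_energy_le (energy β)).prod (finite_energy_le (energy β))).subset ?_
    rintro ⟨a, b⟩ rfl
    simp
  mem_antidiagonal := by simp

theorem antidiagonal_zero : Finset.HasAntidiagonal.antidiagonal (0 : G) = {(0, 0)} := by
  ext ⟨a, b⟩
  simp only [Finset.HasAntidiagonal.mem_antidiagonal, Finset.mem_singleton, Prod.mk.injEq]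
  exact ⟨eq_zero_of_add_eq_zero, fun h => by simp [h.1, h.2]⟩

end GappingMonoid

open GappingMonoid

/-! ### Multilinear families -/

/-- A family of multilinear maps `F^{k,β} : V^{⊗k} → W`, for `k ≥ 0` and `β ∈ G`. The value
`F^{k,β}(x₁ ⊗ ⋯ ⊗ x_k)` is written `F β [x₁, …, x_k]`. -/
structure MultilinearFamily (G : Type v) (V : Type u) (W : Type w) [AddCommGroup V] [Module ℂ V]
    [AddCommGroup W] [Module ℂ W] where
  toFun : G → List V → W
  map_add' : ∀ (β : G) (l : List V) (x y : V) (r : List V),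
    toFun β (l ++ (x + y) :: r) = toFun β (l ++ x :: r) + toFun β (l ++ y :: r)
  map_smul' : ∀ (β : G) (l : List V) (c : ℂ) (x : V) (r : List V),
    toFun β (l ++ (c • x) :: r) = c • toFun β (l ++ x :: r)

instance (G : Type v) (V : Type u) (W : Type w) [AddCommGroup V] [Module ℂ V]
    [AddCommGroup W] [Module ℂ W] :
    CoeFun (MultilinearFamily G V W) fun _ => G → List V → W := ⟨MultilinearFamily.toFun⟩

theorem MultilinearFamily.eq_zero_of_zero {G : Type v} {V : Type u} {W : Type w} [AddCommGroup V]
    [Module ℂ V] [AddCommGroup W] [Module ℂ W] (F : MultilinearFamily G V W) (β : G)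
    (l r : List V) : F β (l ++ 0 :: r) = 0 := by
  simpa using F.map_smul' β l 0 0 r

section Operations

variable {G : Type v} [GappingMonoid G]
variable {V : Type*} {W : Type*} {W' : Type*} [AddCommGroup V] [Module ℂ V]
  [AddCommGroup W] [Module ℂ W] [AddCommGroup W'] [Module ℂ W']

/-- A list of homogeneous elements, each recorded as a pair (degree, element). -/
def IsHomogeneousList (gr : ℤ → Submodule ℂ V) (l : List (ℤ × V)) : Prop :=
  ∀ p ∈ l, p.2 ∈ gr p.1

/-- `F^{k,β}` has degree `e - k` for all `k` and `β`. -/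
def HasDegree (grV : ℤ → Submodule ℂ V) (grW : ℤ → Submodule ℂ W)
    (F : G → List V → W) (e : ℤ) : Prop :=
  ∀ (β : G) (l : List (ℤ × V)), IsHomogeneousList grV l →
    F β (l.map Prod.snd) ∈ grW ((l.map Prod.fst).sum + e - l.length)

/-- The sign `(-1)^♣`, where `♣ = k₁ + ∑ deg x_j`, of a list of `k₁` homogeneous elements. -/
def clubSign (l : List (ℤ × V)) : ℤˣ :=
  Int.negOnePow ((l.length : ℤ) + (l.map Prod.fst).sum)

/-- `∑_{β₁ + β₂ = β} ∑_{k₁ + k' + k₂ = k} (-1)^♣ F^{k₁+1+k₂, β₁} (id^{⊗k₁} ⊗ m^{k',β₂} ⊗ id^{⊗k₂})`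
evaluated on the homogeneous elements `x₁ ⊗ ⋯ ⊗ x_k` given by `l`; here `i = k₁` and `j = k'`. -/
noncomputable def insertionSum (F : G → List V → W) (m : G → List V → V) (β : G)
    (l : List (ℤ × V)) : W :=
  ∑ q ∈ Finset.HasAntidiagonal.antidiagonal β, ∑ i ∈ Finset.range (l.length + 1),
    ∑ j ∈ Finset.range (l.length - i + 1),
      clubSign (l.take i) • F q.1 ((l.take i).map Prod.snd ++
        m q.2 (((l.drop i).take j).map Prod.snd) :: (l.drop (i + j)).map Prod.snd)

/-- `∑ m^{j,β₀} (f^{i₁,β₁} ⊗ ⋯ ⊗ f^{i_j,β_j})` evaluated on the list `l`, the sum over all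
`β₀ + β₁ + ⋯ + β_j = β` and all ways of cutting `l` into `j` consecutive (possibly empty) blocks
of lengths `i₁, …, i_j`. An element of the index set is `β₀` with the list of pairs
(`β_a`, `a`-th block). -/
noncomputable def blockSum (m : G → List W → W') (f : G → List V → W) (β : G) (l : List V) : W' :=
  ∑ᶠ (s : G × List (G × List V))
    (_ : s.1 + (s.2.map Prod.fst).sum = β ∧ (s.2.map Prod.snd).flatten = l),
    m s.1 (s.2.map fun q => f q.1 q.2)

/-- `∑ (-1)^♣ m^{β₀} (F^{β₁}, …, F^{β_r}, h^{γ}, F'^{β'₁}, …, F'^{β'_s})` evaluated on the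
homogeneous elements given by `l`, the sum over all `β₀ + ∑ β_a + γ + ∑ β'_a = β` and all ways of
cutting `l` into `r + 1 + s` consecutive (possibly empty) blocks; the sign is that of the
arguments of the first `r` blocks. -/
noncomputable def homotopySum (m : G → List W → W') (F h F' : G → List V → W) (β : G)
    (l : List (ℤ × V)) : W' :=
  ∑ᶠ (s : G × List (G × List (ℤ × V)) × (G × List (ℤ × V)) × List (G × List (ℤ × V)))
    (_ : s.1 + (s.2.1.map Prod.fst).sum + s.2.2.1.1 + (s.2.2.2.map Prod.fst).sum = β ∧
      (s.2.1.map Prod.snd).flatten ++ s.2.2.1.2 ++ (s.2.2.2.map Prod.snd).flatten = l),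
    clubSign (s.2.1.map Prod.snd).flatten •
      m s.1 (s.2.1.map (fun q => F q.1 (q.2.map Prod.snd)) ++
        h s.2.2.1.1 (s.2.2.1.2.map Prod.snd) ::
          s.2.2.2.map (fun q => F' q.1 (q.2.map Prod.snd)))

open Classical in
/-- The components of the identity `A_∞` homomorphism: `id^{1,0} = id`, all others vanish. -/
noncomputable def identityFamily : G → List V → V
  | β, [x] => if β = 0 then x else 0
  | _, _ => 0

end Operations

/-! ### Gapped filtered `A_∞` algebras -/

/-- A `G`-gapped filtered `A_∞` algebra satisfying the gapped `A_∞` relations, given by the graded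
complex vector space `B̲` and its operations `m^{k,β} : B̲^{⊗k} → B̲` of degree `2 - k`. The
underlying filtered `A_∞` algebra is the completed free module `B = B̲ ⊗ Λ_{≥0}` over the Novikov
ring with `m^k = ∑_β T^{ω(β)} m^{k,β}`; its curvature has positive valuation. -/
structure GappedAInfinity (G : Type v) [GappingMonoid G] where
  carrier : Type u
  [addCommGroup : AddCommGroup carrier]
  [module : Module ℂ carrier]
  gr : ℤ → Submodule ℂ carrier
  isInternal : DirectSum.IsInternal gr
  m : MultilinearFamily G carrier carrier
  degree_m : HasDegree gr gr m 2
  curvature_zero : m 0 [] = 0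
  relation : ∀ (β : G) (l : List (ℤ × carrier)), IsHomogeneousList gr l →
    insertionSum m m β l = 0

attribute [instance] GappedAInfinity.addCommGroup GappedAInfinity.module

instance (G : Type v) [GappingMonoid G] : CoeSort (GappedAInfinity.{u} G) (Type u) :=
  ⟨GappedAInfinity.carrier⟩

namespace GappedAInfinity

variable {G : Type v} [GappingMonoid G]

/-- `b = ∑_{β ≠ 0} T^{ω(β)} b_β` with all `b_β` of degree one. -/
structure IsDeformingCochain (B : GappedAInfinity.{u} G) (b : G → B) : Prop where
  zero : b 0 = 0
  degree : ∀ β, b β ∈ B.gr 1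

/-- The operation `m^{k,β}_{(B,b)}` of the deformation of `B` by `b = ∑_β b_β`: the sum of
`m^{k+l,β₀}(b_{β_{0,1}}, …, b_{β_{0,l₀}}, x₁, b_{β_{1,1}}, …, b_{β_{1,l₁}}, x₂, …, x_k,
b_{β_{k,1}}, …, b_{β_{k,l_k}})` over `β₀` and all finite lists `(β_{i,1}, …, β_{i,l_i})`,
`0 ≤ i ≤ k`, for which `β₀` and all `β_{i,j}` add up to `β`. In the index `s`, the entry `s.1`
is `β₀`, `s.2.1` is the list in front of `x₁`, and `s.2.2` has the `k` remaining lists. -/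
noncomputable def deformedOp (B : GappedAInfinity.{u} G) (b : G → B) (β : G) (x : List B) : B :=
  ∑ᶠ (s : G × List G × List (List G))
    (_ : s.2.2.length = x.length ∧ s.1 + s.2.1.sum + s.2.2.flatten.sum = β),
    B.m s.1 (s.2.1.map b ++ (List.zipWith (fun y L => y :: L.map b) x s.2.2).flatten)

/-- A deforming cochain for which every component `m^{0,β}_{(B,b)}` of the deformed curvature
vanishes. -/
structure IsBoundingCochain (B : GappedAInfinity.{u} G) (b : G → B) : Prop
    extends B.IsDeformingCochain b where
  curvature : ∀ β : G, B.deformedOp b β [] = 0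

/-! ### Homomorphisms and homotopy equivalence -/

/-- Gapped filtered `A_∞` homomorphisms, possibly with `f^0 ≠ 0` (of positive energy). -/
structure Hom (X : GappedAInfinity.{u} G) (Y : GappedAInfinity.{w} G) where
  f : MultilinearFamily G X Y
  degree_f : HasDegree X.gr Y.gr f 1
  zero : f 0 [] = 0
  relation : ∀ (β : G) (l : List (ℤ × X)), IsHomogeneousList X.gr l →
    insertionSum f X.m β l = blockSum Y.m f β (l.map Prod.snd)

/-- The components of the composite `A_∞` homomorphism `g ∘ f`. -/
noncomputable def compFamily {X : GappedAInfinity.{u} G} {Y : GappedAInfinity.{w} G}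
    {Z : GappedAInfinity.{u} G} (g : Hom Y Z) (f : Hom X Y) : G → List X → Z :=
  blockSum g.f f.f

/-- An `A_∞` homotopy between `F` and `F'` (the components of `A_∞` homomorphisms `X → Y`): maps
`h^{k,β}` of degree `-k`, the components of an `(F, F')`-coderivation `H` with
`F - F' = m_Y ∘ H + H ∘ m_X`. -/
structure Homotopy {X : GappedAInfinity.{u} G} {Y : GappedAInfinity.{w} G}
    (F F' : G → List X → Y) where
  h : MultilinearFamily G X Y
  degree_h : HasDegree X.gr Y.gr h 0
  zero : h 0 [] = 0
  relation : ∀ (β : G) (l : List (ℤ × X)), IsHomogeneousList X.gr l →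
    F β (l.map Prod.snd) - F' β (l.map Prod.snd) =
      homotopySum Y.m F h F' β l + insertionSum h X.m β l

/-- `X` and `Y` are homotopy equivalent as gapped filtered `A_∞` algebras. -/
def HomotopyEquivalent (X : GappedAInfinity.{u} G) (Y : GappedAInfinity.{w} G) : Prop :=
  ∃ (f : Hom X Y) (g : Hom Y X),
    Nonempty (Homotopy (X := X) (Y := X) (compFamily g f) identityFamily) ∧
    Nonempty (Homotopy (X := Y) (Y := Y) (compFamily f g) identityFamily)

/-- `X` is an anticommutative differential graded algebra: only `m^1` and `m^2` may be nonzero,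
the differential `m^1` has no terms of positive energy (it is the scalar extension of a
differential on the complex vector space `X̲`), and `m^2` is graded anticommutative for the
shifted degrees `deg x + 1`. In the present sign convention the latter says that the product `xy`
with `m^2(x,y) = (-1)^{deg x} xy` satisfies `yx = (-1)^{deg x deg y} xy`. -/
structure IsAnticommutativeDGA (X : GappedAInfinity.{u} G) : Prop where
  vanish : ∀ (β : G) (l : List X), l.length ≠ 1 → l.length ≠ 2 → X.m β l = 0
  differential : ∀ (β : G) (x : X), β ≠ 0 → X.m β [x] = 0
  anticomm : ∀ (β : G) (i j : ℤ) (x y : X), x ∈ X.gr i → y ∈ X.gr j →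
    X.m β [x, y] = -(Int.negOnePow ((i + 1) * (j + 1)) • X.m β [y, x])

/-! ### The complex of lowest-energy terms -/

theorem m_single_mem (X : GappedAInfinity.{u} G) {i j : ℤ} (hij : i + 1 = j) {x : X}
    (hx : x ∈ X.gr i) : X.m 0 [x] ∈ X.gr j := by
  have h := X.degree_m 0 [(i, x)] (by simpa [IsHomogeneousList] using hx)
  have e : i + 2 - 1 = j := by omega
  simpa [e] using h

theorem m_m_single (X : GappedAInfinity.{u} G) {i : ℤ} {x : X} (hx : x ∈ X.gr i) :
    X.m 0 [X.m 0 [x]] = 0 := by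
  have h := X.relation 0 [(i, x)] (by simpa [IsHomogeneousList] using hx)
  have z1 : X.m 0 [0, x] = 0 := X.m.eq_zero_of_zero 0 [] [x]
  have z2 : X.m 0 [x, 0] = 0 := X.m.eq_zero_of_zero 0 [x] []
  simpa [insertionSum, antidiagonal_zero, Finset.sum_range_succ, X.curvature_zero, z1, z2,
    clubSign] using h

/-- The differential `m^{1,0} : X̲ → X̲`. -/
def lowestDifferential (X : GappedAInfinity.{u} G) : X →ₗ[ℂ] X where
  toFun x := X.m 0 [x]
  map_add' x y := X.m.map_add' 0 [] x y []
  map_smul' c x := X.m.map_smul' 0 [] c x []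

/-- The cochain complex `X̲ = X / X_{>0}` with differential `m^{1,0}`. -/
def underline (X : GappedAInfinity.{u} G) : CochainComplex (ModuleCat.{u} ℂ) ℤ where
  X i := ModuleCat.of ℂ (X.gr i)
  d i j := if h : i + 1 = j then
    ModuleCat.ofHom (X.lowestDifferential.restrict fun _ hx => X.m_single_mem h hx) else 0
  shape i j h := dif_neg h
  d_comp_d' i j k hij hjk := by
    have hij' : i + 1 = j := hij
    have hjk' : j + 1 = k := hjk
    rw [dif_pos hij', dif_pos hjk']
    refine ModuleCat.hom_ext (LinearMap.ext fun x => ?_)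
    exact Subtype.ext (X.m_m_single x.2)

/-- The chain map `X̲ → Y̲` given by a degree preserving linear map commuting with `m^{1,0}`. -/
def underlineMap {X Y : GappedAInfinity.{u} G} (φ : X →ₗ[ℂ] Y)
    (hdeg : ∀ i, ∀ x ∈ X.gr i, φ x ∈ Y.gr i) (hφ : ∀ x, φ (X.m 0 [x]) = Y.m 0 [φ x]) :
    X.underline ⟶ Y.underline where
  f i := ModuleCat.ofHom (φ.restrict (hdeg i))
  comm' i j hij := by
    have hij' : i + 1 = j := hij
    simp only [underline, dif_pos hij']
    refine ModuleCat.hom_ext (LinearMap.ext fun x => ?_)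
    exact Subtype.ext (hφ x.1).symm

/-! ### Ideals -/

/-- A strong `A_∞` ideal of `B`: a graded subspace `A` such that `m^{k,β}` takes values in `A`
as soon as one of its `k > 0` arguments is in `A`, and which contains the curvature. -/
structure StrongIdeal (B : GappedAInfinity.{u} G) where
  carrier : Submodule ℂ B
  graded : carrier ≤ ⨆ i, B.gr i ⊓ carrier
  absorbs : ∀ (β : G) (l : List B) (a : B) (r : List B), a ∈ carrier →
    B.m β (l ++ a :: r) ∈ carrier
  curvature_mem : ∀ β : G, B.m β [] ∈ carrier

namespace StrongIdeal

variable {B : GappedAInfinity.{u} G} (A : StrongIdeal B)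

theorem sub_internal :
    DirectSum.IsInternal fun i => (B.gr i).comap A.carrier.subtype := by
  rw [DirectSum.isInternal_submodule_iff_iSupIndep_and_iSup_eq_top]
  have hB := (DirectSum.isInternal_submodule_iff_iSupIndep_and_iSup_eq_top _).mp B.isInternal
  have hmap : ∀ i, ((B.gr i).comap A.carrier.subtype).map A.carrier.subtype ≤ B.gr i :=
    fun i => Submodule.map_comap_le _ _
  constructor
  · intro i
    rw [Submodule.disjoint_def]
    intro x hx hx'
    have h1 : (x : B) ∈ ⨆ j, ⨆ (_ : j ≠ i), B.gr j := by
      have h2 := Submodule.mem_map_of_mem (f := A.carrier.subtype) hx'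
      simp only [Submodule.map_iSup] at h2
      exact (iSup₂_mono fun j _ => hmap j) h2
    exact Subtype.ext (Submodule.disjoint_def.mp (hB.1 i) _ hx h1)
  · apply Submodule.map_injective_of_injective A.carrier.injective_subtype
    rw [Submodule.map_iSup, Submodule.map_subtype_top]
    simp only [Submodule.map_comap_subtype]
    refine le_antisymm (iSup_le fun i => inf_le_left) ?_
    simpa only [inf_comm] using A.graded

theorem quotient_internal :
    DirectSum.IsInternal fun i => (B.gr i).map A.carrier.mkQ := by
  classical
  rw [DirectSum.isInternal_submodule_iff_iSupIndep_and_iSup_eq_top]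
  have hB := (DirectSum.isInternal_submodule_iff_iSupIndep_and_iSup_eq_top _).mp B.isInternal
  let _ := B.isInternal.chooseDecomposition
  let P : ℤ → B →ₗ[ℂ] B := fun i =>
    (B.gr i).subtype ∘ₗ DirectSum.component ℂ ℤ (fun i => B.gr i) i ∘ₗ
      (DirectSum.decomposeLinearEquiv B.gr).toLinearMap
  have P_same : ∀ i, ∀ x ∈ B.gr i, P i x = x := fun i x hx =>
    DirectSum.decompose_of_mem_same B.gr hx
  have P_ne : ∀ i j, j ≠ i → ∀ x ∈ B.gr j, P i x = 0 := fun i j hij x hx =>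
    DirectSum.decompose_of_mem_ne B.gr hx hij
  have P_A : ∀ i, A.carrier ≤ A.carrier.comap (P i) := by
    intro i
    refine A.graded.trans (iSup_le fun j => ?_)
    rintro x ⟨hx, hxA⟩
    by_cases hij : j = i
    · subst hij
      simpa [P_same j x hx] using hxA
    · simp [P_ne i j hij x hx]
  constructor
  · intro i
    rw [Submodule.disjoint_def]
    rintro _ ⟨x, hx, rfl⟩ hx'
    let p := A.carrier.mapQ A.carrier (P i) (P_A i)
    have h1 : p (A.carrier.mkQ x) = A.carrier.mkQ x := by
      simp [p, P_same i x hx]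
    have h2 : (⨆ j, ⨆ (_ : j ≠ i), (B.gr j).map A.carrier.mkQ) ≤ LinearMap.ker p := by
      refine iSup₂_le fun j hij => ?_
      rintro _ ⟨y, hy, rfl⟩
      simp [p, P_ne i j hij y hy]
    rw [← h1]
    exact h2 hx'
  · rw [← Submodule.map_iSup, hB.2, Submodule.map_top, Submodule.range_mkQ]

theorem m_mem_of_exists_mem {β : G} {l : List B} (h : ∃ a ∈ l, a ∈ A.carrier) :
    B.m β l ∈ A.carrier := by
  obtain ⟨a, hl, ha⟩ := h
  obtain ⟨s, t, rfl⟩ := List.append_of_mem hl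
  exact A.absorbs β s a t ha

theorem m_mem (β : G) (l : List A.carrier) :
    B.m β (l.map A.carrier.subtype) ∈ A.carrier := by
  cases l with
  | nil => exact A.curvature_mem β
  | cons a r => exact A.absorbs β [] a _ a.2

/-- The strong ideal `A` as a gapped filtered `A_∞` algebra. -/
def algebra : GappedAInfinity.{u} G where
  carrier := A.carrier
  gr i := (B.gr i).comap A.carrier.subtype
  isInternal := A.sub_internal
  m :=
    { toFun := fun β l => ⟨B.m β (l.map A.carrier.subtype), A.m_mem β l⟩
      map_add' := fun β l x y r => Subtype.ext <| by
        simpa using B.m.map_add' β (l.map A.carrier.subtype) x y (r.map A.carrier.subtype)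
      map_smul' := fun β l c x r => Subtype.ext <| by
        simpa using B.m.map_smul' β (l.map A.carrier.subtype) c x (r.map A.carrier.subtype) }
  degree_m β l hl := by
    have h := B.degree_m β (l.map fun p => (p.1, (p.2 : B))) (by
      intro p hp
      obtain ⟨q, hq, rfl⟩ := List.mem_map.mp hp
      exact hl q hq)
    simpa [Function.comp_def] using h
  curvature_zero := Subtype.ext B.curvature_zero
  relation β l hl := by
    have h := B.relation β (l.map fun p => (p.1, (p.2 : B))) (by
      intro p hp
      obtain ⟨q, hq, rfl⟩ := List.mem_map.mp hp
      exact hl q hq)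
    apply Subtype.ext
    rw [ZeroMemClass.coe_zero, ← h]
    simp only [insertionSum, AddSubmonoidClass.coe_finsetSum, List.length_map]
    refine Finset.sum_congr rfl fun q _ => Finset.sum_congr rfl fun i _ =>
      Finset.sum_congr rfl fun j _ => ?_
    simp [clubSign, Units.smul_def, ← List.map_take, ← List.map_drop, Function.comp_def]

/-- A linear section of the projection `B̲ → B̲ / A̲`, used to write down the operations of the
quotient; they do not depend on it, see `mkQ_m`. -/
noncomputable def quotientSection : (B ⧸ A.carrier) →ₗ[ℂ] B :=
  (A.carrier.mkQ.exists_rightInverse_of_surjective A.carrier.range_mkQ).choose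

theorem mkQ_section (x : B ⧸ A.carrier) : A.carrier.mkQ (A.quotientSection x) = x :=
  LinearMap.congr_fun
    (A.carrier.mkQ.exists_rightInverse_of_surjective A.carrier.range_mkQ).choose_spec x

theorem mkQ_m_congr (β : G) (s l l' : List B)
    (h : l.map A.carrier.mkQ = l'.map A.carrier.mkQ) :
    A.carrier.mkQ (B.m β (s ++ l)) = A.carrier.mkQ (B.m β (s ++ l')) := by
  induction l generalizing s l' with
  | nil =>
    cases l' with
    | nil => rfl
    | cons y r' => simp at h
  | cons x r ih =>
    cases l' with
    | nil => simp at h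
    | cons y r' =>
      simp only [List.map_cons, List.cons.injEq] at h
      have h1 := ih (s ++ [x]) r' h.2
      simp only [List.append_assoc, List.singleton_append] at h1
      rw [h1]
      have h2 : x - y ∈ A.carrier := by
        have := sub_eq_zero.mpr h.1
        rwa [← map_sub, Submodule.mkQ_apply, Submodule.Quotient.mk_eq_zero] at this
      have h3 := B.m.map_add' β s (x - y) y r'
      rw [sub_add_cancel] at h3
      rw [h3, map_add, add_eq_right, Submodule.mkQ_apply, Submodule.Quotient.mk_eq_zero]
      exact A.absorbs β s _ r' h2

/-- The operations of the quotient: `m_C([x₁], …, [x_k]) = [m_B(x₁, …, x_k)]`. -/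
noncomputable def quotientOp : MultilinearFamily G (B ⧸ A.carrier) (B ⧸ A.carrier) where
  toFun β l := A.carrier.mkQ (B.m β (l.map A.quotientSection))
  map_add' β l x y r := by
    simp only [List.map_append, List.map_cons, map_add, B.m.map_add']
  map_smul' β l c x r := by
    simp only [List.map_append, List.map_cons, map_smul, B.m.map_smul']

theorem mkQ_m (β : G) (l : List B) :
    A.quotientOp β (l.map A.carrier.mkQ) = A.carrier.mkQ (B.m β l) := by
  refine A.mkQ_m_congr β [] _ _ ?_
  simp only [List.map_map, Function.comp_def, mkQ_section]

theorem exists_lift (l : List (ℤ × (B ⧸ A.carrier)))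
    (hl : IsHomogeneousList (fun i => (B.gr i).map A.carrier.mkQ) l) :
    ∃ l' : List (ℤ × B), IsHomogeneousList B.gr l' ∧
      l = l'.map fun p => (p.1, A.carrier.mkQ p.2) := by
  induction l with
  | nil => exact ⟨[], by simp [IsHomogeneousList], rfl⟩
  | cons p r ih =>
    obtain ⟨r', hr', rfl⟩ := ih fun q hq => hl q (List.mem_cons_of_mem _ hq)
    obtain ⟨x, hx, hxp⟩ := hl p List.mem_cons_self
    refine ⟨(p.1, x) :: r', ?_, ?_⟩
    · intro q hq
      rcases List.mem_cons.mp hq with rfl | hq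
      · exact hx
      · exact hr' q hq
    · exact congrArg (· :: _) (Prod.ext rfl hxp.symm)

/-- The quotient `C = B / A` as a gapped filtered `A_∞` algebra. -/
noncomputable def quotient : GappedAInfinity.{u} G where
  carrier := B ⧸ A.carrier
  gr i := (B.gr i).map A.carrier.mkQ
  isInternal := A.quotient_internal
  m := A.quotientOp
  degree_m β l hl := by
    obtain ⟨l', hl', rfl⟩ := A.exists_lift l hl
    have h := Submodule.mem_map_of_mem (f := A.carrier.mkQ) (B.degree_m β l' hl')
    rw [← A.mkQ_m] at h
    simpa [Function.comp_def] using h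
  curvature_zero := by
    have h := A.mkQ_m 0 []
    rw [B.curvature_zero, map_zero] at h
    exact h
  relation β l hl := by
    obtain ⟨l', hl', rfl⟩ := A.exists_lift l hl
    rw [← map_zero A.carrier.mkQ, ← B.relation β l' hl']
    simp only [insertionSum, map_sum, List.length_map]
    refine Finset.sum_congr rfl fun q _ => Finset.sum_congr rfl fun i _ =>
      Finset.sum_congr rfl fun j _ => ?_
    rw [Units.smul_def, Units.smul_def, map_zsmul, ← A.mkQ_m]
    simp only [List.map_append, List.map_cons, ← A.mkQ_m]
    simp [clubSign, ← List.map_take, ← List.map_drop, Function.comp_def]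

/-- The inclusion `A̲ → B̲`. -/
def inclusion : A.algebra.underline ⟶ B.underline :=
  underlineMap (X := A.algebra) A.carrier.subtype (fun _ _ hx => hx) fun _ => rfl

/-- The projection `B̲ → C̲` as a linear map. -/
noncomputable def projectionLinear : B →ₗ[ℂ] A.quotient where
  toFun x := A.carrier.mkQ x
  map_add' := map_add A.carrier.mkQ
  map_smul' := map_smul A.carrier.mkQ

/-- The projection `B̲ → C̲` as a chain map. -/
noncomputable def projection : B.underline ⟶ A.quotient.underline :=
  underlineMap (Y := A.quotient) A.projectionLinear (fun _ x hx => ⟨x, hx, rfl⟩)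
    fun x => (A.mkQ_m 0 [x]).symm

/-- The sequence of complexes `A̲ → B̲ → C̲`. -/
noncomputable def shortComplex : ShortComplex (CochainComplex (ModuleCat.{u} ℂ) ℤ) :=
  ShortComplex.mk A.inclusion A.projection <| by
    ext i x
    exact Subtype.ext ((Submodule.Quotient.mk_eq_zero _).mpr (Subtype.prop x.1))

theorem shortExact : A.shortComplex.ShortExact := by
  apply HomologicalComplex.shortExact_of_degreewise_shortExact
  intro i
  apply ModuleCat.shortComplex_shortExact
  · intro y
    constructor
    · intro hy
      have h1 : A.carrier.mkQ y.1 = 0 := congrArg Subtype.val hy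
      have h2 : y.1 ∈ A.carrier := (Submodule.Quotient.mk_eq_zero _).mp h1
      exact ⟨⟨⟨y.1, h2⟩, y.2⟩, rfl⟩
    · rintro ⟨x, rfl⟩
      exact Subtype.ext ((Submodule.Quotient.mk_eq_zero _).mpr (Subtype.prop x.1))
  · intro x y h
    exact Subtype.ext (Subtype.ext (congrArg (fun z : B.gr i => (z : B)) h))
  · rintro ⟨_, x, hx, rfl⟩
    exact ⟨⟨x, hx⟩, rfl⟩

/-- The connecting homomorphism `δ : H¹(C̲) → H²(A̲)`. -/
noncomputable def connectingMap :
    A.quotient.underline.homology 1 ⟶ A.algebra.underline.homology 2 :=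
  A.shortExact.δ 1 2 rfl

end StrongIdeal

end GappedAInfinity

/-!
The bounding cochain is constructed one energy level at a time. Let `C = B / A`, let `D` be the
anticommutative DGA, and let `f : C → D` and `g : D → C` be the homotopy equivalences. Besides the
components `b_β` of the cochain, the recursion chooses cocycles `e_β` of degree one in `D`, such
that `b` is a lift of the push-forward `g_* e = ∑_l g^l(e, …, e)` to `B`.

Anticommutativity makes the quadratic terms of the curvature of `D` cancel in pairs, so any family
`e` of cocycles of degree one solves the Maurer–Cartan equation in `D`
(`IsAnticommutativeDGA.evalExp_eq_zero`), and its push-forward solves it in `C`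
(`Hom.evalExp_eq_zero`). Hence the curvature of the deformation of `B` by `b` takes values in `A`.
Its first nonzero component `o_β` is a cocycle by the Bianchi identity (`m_evalExp_eq_zero`). As
`δ` is onto, `H²(A̲) → H²(B̲)` vanishes, so `o_β = m^{1,0}(y)` for some `y` in `B̲¹`
(`StrongIdeal.exists_primitive`). Replacing `b_β` by `b_β - y` removes `o_β`, but the image of the
new `b` in `C` has to remain a push-forward. The image `c` of `y` in `C̲` is a cocycle, and by the
homotopy `g^{1,0}(f^{1,0}(c))` differs from it by a coboundary, so that `y` can be chosen with image
`g^{1,0}(f^{1,0}(c))` (`StrongIdeal.exists_primitive_of_homotopy`); then subtracting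
`f^{1,0}(c)` from `e_β` restores the relation between `e` and `b`. The components of `g_* e` at
higher energies change as well, but these have not been lifted yet.

The combinatorial part concerns `evalExp F b`, the components of `∑_l F^l(b, …, b)`. Evaluation
turns the insertion sum into the linearization of `F` at `b` (`sum_insertionSum`), with all signs
trivial in degree one, and the sum over blocks into an iterated evaluation (`evalExp_blockSum`).
Decompositions into nonzero summands are used throughout, as there are only finitely many of them.
-/

/-! ### Decompositions of an element of the gapping monoid -/

namespace GappingMonoid

variable {G : Type v} [GappingMonoid G]

/-- Energies cannot decrease forever: only finitely many elements lie below a given energy. -/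
theorem wellFounded_energy_lt : WellFounded fun β γ : G => energy β < energy γ := by
  have hfin : ∀ γ : G, {α : G | energy α < energy γ}.Finite := fun γ =>
    (finite_energy_le (energy γ)).subset fun α (hα : energy α < energy γ) => hα.le
  refine Subrelation.wf (r := InvImage (· < ·) fun γ : G => {α : G | energy α < energy γ}.ncard)
    (fun {β γ} h => ?_) (InvImage.wf _ wellFounded_lt)
  refine Set.ncard_lt_ncard ⟨fun α hα => lt_trans hα h, fun hsub => ?_⟩ (hfin γ)
  exact lt_irrefl (energy β) (hsub (show β ∈ {α : G | energy α < energy γ} from h))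

theorem energy_pos {β : G} (h : β ≠ 0) : 0 < energy β :=
  pos_iff_ne_zero.mpr fun h0 => h (eq_zero_of_energy β h0)

theorem energy_lt_add_left {α β : G} (h : α ≠ 0) : energy β < energy (α + β) := by
  rw [map_add]
  exact lt_add_of_pos_left _ (energy_pos h)

theorem list_sum_eq_zero {L : List G} (h : L.sum = 0) : ∀ γ ∈ L, γ = 0 := by
  induction L with
  | nil => simp
  | cons a r ih =>
    rw [List.sum_cons] at h
    obtain ⟨h1, h2⟩ := eq_zero_of_add_eq_zero h
    intro γ hγ
    rcases List.mem_cons.mp hγ with rfl | hγ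
    · exact h1
    · exact ih h2 γ hγ

/-- There are finitely many lists of nonzero elements with a given sum, by induction on the energy:
removing the first entry lowers it, and there are finitely many choices for this entry. -/
theorem finite_zeroFree_lists (β : G) : {L : List G | 0 ∉ L ∧ L.sum = β}.Finite := by
  induction β using (wellFounded_energy_lt (G := G)).induction with
  | h β ih =>
    have hfin : ∀ q ∈ (↑(Finset.HasAntidiagonal.antidiagonal β) : Set (G × G)),
        (List.cons q.1 '' {L : List G | q.1 ≠ 0 ∧ 0 ∉ L ∧ L.sum = q.2}).Finite := by
      intro q hq
      have hq' : q.1 + q.2 = β := by simpa using hq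
      by_cases h0 : q.1 = 0
      · simp [h0]
      · refine ((ih q.2 ?_).subset fun L hL => hL.2).image _
        rw [← hq']
        exact energy_lt_add_left h0
    refine ((Set.finite_singleton []).union
      ((Finset.finite_toSet _).biUnion hfin)).subset ?_
    rintro (_ | ⟨a, r⟩) ⟨h1, h2⟩
    · exact Or.inl rfl
    · right
      simp only [List.mem_cons, not_or] at h1
      refine Set.mem_biUnion (x := (a, r.sum)) ?_ ⟨r, ⟨fun h => h1.1 h.symm, h1.2, rfl⟩, rfl⟩
      simpa using h2

theorem finite_decompositions (β : G) :
    {s : G × List G | 0 ∉ s.2 ∧ s.1 + s.2.sum = β}.Finite := by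
  refine ((Finset.finite_toSet (Finset.HasAntidiagonal.antidiagonal β)).biUnion
    (t := fun q => Prod.mk q.1 '' {L : List G | 0 ∉ L ∧ L.sum = q.2})
    fun q _ => (finite_zeroFree_lists q.2).image _).subset ?_
  rintro ⟨a, L⟩ ⟨h1, h2⟩
  refine Set.mem_biUnion (x := (a, L.sum)) (by simpa using h2) ⟨L, ⟨h1, rfl⟩, rfl⟩

/-- The decompositions `β = β₀ + β₁ + ⋯ + β_l` with `β₁, …, β_l` nonzero, as pairs of `β₀` and
the list of the other summands. -/
noncomputable def decompositions (β : G) : Finset (G × List G) :=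
  (finite_decompositions β).toFinset

theorem mem_decompositions {β : G} {s : G × List G} :
    s ∈ decompositions β ↔ 0 ∉ s.2 ∧ s.1 + s.2.sum = β := by
  simp [decompositions]

theorem decompositions_zero : decompositions (0 : G) = {(0, [])} := by
  ext ⟨a, L⟩
  rw [mem_decompositions, Finset.mem_singleton]
  constructor
  · rintro ⟨h1, h2⟩
    obtain ⟨rfl, h3⟩ := eq_zero_of_add_eq_zero h2
    cases L with
    | nil => rfl
    | cons x r =>
      exact absurd (list_sum_eq_zero h3 x List.mem_cons_self) fun h => h1 (by simp [h])
  · rintro h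
    simp_all

/-- In a decomposition of `β` other than `β = 0 + β`, the nonzero summands have smaller energy
than `β`. -/
theorem energy_lt_of_mem_decompositions {β : G} {s : G × List G} (hs : s ∈ decompositions β)
    (hne : s ≠ (0, [β])) : ∀ γ ∈ s.2, energy γ < energy β := by
  obtain ⟨a, L⟩ := s
  obtain ⟨h1, h2⟩ := mem_decompositions.mp hs
  intro γ hγ
  obtain ⟨l, r, rfl⟩ := List.append_of_mem hγ
  dsimp only at h1 h2
  have e : a + (l ++ γ :: r).sum = (a + l.sum + r.sum) + γ := by
    simp only [List.sum_append, List.sum_cons]; abel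
  rw [← h2, e]
  refine energy_lt_add_left fun h0 => hne ?_
  obtain ⟨h3, hr⟩ := eq_zero_of_add_eq_zero h0
  obtain ⟨rfl, hl⟩ := eq_zero_of_add_eq_zero h3
  have nil : ∀ K : List G, 0 ∉ K → K.sum = 0 → K = [] := by
    rintro (_ | ⟨x, K⟩) hK hs
    · rfl
    · exact absurd (list_sum_eq_zero hs x List.mem_cons_self) fun h => hK (by simp [h])
  obtain rfl := nil l (fun h => h1 (by simp [h])) hl
  obtain rfl := nil r (fun h => h1 (by simp [h])) hr
  simpa using h2

/-- Recursion along the energy: a family `u` with property `P β` at each `β` exists if `P β u`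
depends only on the values of `u` at `β` and at elements of smaller energy, and if a family with
the property at all smaller energies can be corrected at `β`. -/
theorem exists_forall_of_step {α : Type*} [Nonempty α] (P : G → (G → α) → Prop)
    (hP : ∀ β (u u' : G → α), u β = u' β → (∀ γ, energy γ < energy β → u γ = u' γ) →
      P β u → P β u')
    (step : ∀ β (u : G → α), (∀ γ, energy γ < energy β → P γ u) →
      ∃ u' : G → α, (∀ γ, energy γ < energy β → u' γ = u γ) ∧ P β u') :
    ∃ u : G → α, ∀ β, P β u := by
  classical
  let ext : ∀ β : G, (∀ γ, energy γ < energy β → α) → G → α := fun β v γ =>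
    if h : energy γ < energy β then v γ h else Classical.arbitrary α
  let next : ∀ β : G, (∀ γ, energy γ < energy β → α) → α := fun β v =>
    if h : ∃ u' : G → α, (∀ γ, energy γ < energy β → u' γ = ext β v γ) ∧ P β u' then
      h.choose β else Classical.arbitrary α
  let u : G → α := wellFounded_energy_lt.fix next
  have hu : ∀ β, u β = next β fun γ _ => u γ := fun β => wellFounded_energy_lt.fix_eq next β
  refine ⟨u, fun β => ?_⟩
  induction β using (wellFounded_energy_lt (G := G)).induction with
  | h β ih =>
    have hext : ∀ γ, energy γ < energy β → ext β (fun γ _ => u γ) γ = u γ := fun γ h => dif_pos h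
    have hex : ∃ u' : G → α, (∀ γ, energy γ < energy β → u' γ = ext β (fun γ _ => u γ) γ) ∧
        P β u' := by
      refine step β _ fun γ hγ => ?_
      exact hP γ u _ (hext γ hγ).symm (fun δ hδ => (hext δ (hδ.trans hγ)).symm) (ih γ hγ)
    have hval : u β = hex.choose β := by rw [hu β]; exact dif_pos hex
    exact hP β hex.choose u hval.symm
      (fun γ hγ => (hex.choose_spec.1 γ hγ).trans (hext γ hγ)) hex.choose_spec.2

end GappingMonoid

/-! ### Evaluation of multilinear families on group-like elements -/

namespace MultilinearFamily

variable {G : Type v} {V : Type*} {W : Type*} [AddCommGroup V] [Module ℂ V]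
  [AddCommGroup W] [Module ℂ W]

theorem map_sum (F : MultilinearFamily G V W) (β : G) (l r : List V) {ι : Type*} (s : Finset ι)
    (u : ι → V) : F β (l ++ (∑ i ∈ s, u i) :: r) = ∑ i ∈ s, F β (l ++ u i :: r) := by
  classical
  induction s using Finset.induction_on with
  | empty => simpa using F.eq_zero_of_zero β l r
  | insert a s ha ih => rw [Finset.sum_insert ha, Finset.sum_insert ha, F.map_add', ih]

theorem eq_zero_of_mem (F : MultilinearFamily G V W) (β : G) {l : List V} (h : (0 : V) ∈ l) :
    F β l = 0 := by
  obtain ⟨s, t, rfl⟩ := List.append_of_mem h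
  exact F.eq_zero_of_zero β s t

end MultilinearFamily

section EvalExp

variable {G : Type v} [GappingMonoid G] {V : Type*} {W : Type*} [AddCommGroup W]

/-- The component at `β` of `∑_l F^l(b, …, b)` for `b = ∑_{β ≠ 0} T^{ω(β)} b_β`: the sum of
`F^{l,β₀}(b_{β₁}, …, b_{β_l})` over the decompositions `β = β₀ + β₁ + ⋯ + β_l` with
`β₁, …, β_l` nonzero. In terms of the tensor coalgebra this evaluates `F` on the group-like element
`∑_l b ⊗ ⋯ ⊗ b`. The value `b 0` is not used. -/
noncomputable def evalExp (F : G → List V → W) (b : G → V) (β : G) : W :=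
  ∑ s ∈ decompositions β, F s.1 (s.2.map b)

theorem evalExp_zero (F : G → List V → W) (b : G → V) : evalExp F b 0 = F 0 [] := by
  simp [evalExp, decompositions_zero]

/-- Apart from the term `F^{1,0}(b_β)`, the component at `β` only involves components of `b` of
energy smaller than that of `β`. -/
theorem evalExp_sub_single {F : G → List V → W} {b b' : G → V} {β : G} (hβ : β ≠ 0)
    (h : ∀ γ, energy γ < energy β → b γ = b' γ) :
    evalExp F b β - F 0 [b β] = evalExp F b' β - F 0 [b' β] := by
  classical
  have hmem : ((0, [β]) : G × List G) ∈ decompositions β := by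
    simpa [mem_decompositions] using hβ.symm
  have key : ∀ c : G → V, evalExp F c β - F 0 [c β] =
      ∑ s ∈ (decompositions β).erase (0, [β]), F s.1 (s.2.map c) := by
    intro c
    rw [evalExp, ← Finset.add_sum_erase _ _ hmem]
    simp
  rw [key, key]
  refine Finset.sum_congr rfl fun s hs => ?_
  rw [Finset.mem_erase] at hs
  congr 1
  exact List.map_congr_left fun γ hγ => h γ (energy_lt_of_mem_decompositions hs.2 hs.1 γ hγ)

theorem evalExp_congr {F : G → List V → W} {b b' : G → V} {β : G} (h0 : b β = b' β)
    (h : ∀ γ, energy γ < energy β → b γ = b' γ) : evalExp F b β = evalExp F b' β := by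
  by_cases hβ : β = 0
  · subst hβ
    rw [evalExp_zero, evalExp_zero]
  · have := evalExp_sub_single (F := F) hβ h
    rwa [h0, sub_left_inj] at this

/-- The component at `γ` of `y ↦ ∑ F(b, …, b, y, b, …, b)`. -/
noncomputable def linearizedExp (F : G → List V → W) (b : G → V) (γ : G) (y : V) : W :=
  ∑ s ∈ decompositions γ, ∑ i ∈ Finset.range (s.2.length + 1),
    F s.1 ((s.2.take i).map b ++ y :: (s.2.drop i).map b)

theorem linearizedExp_zero (F : G → List V → W) (b : G → V) (y : V) :
    linearizedExp F b 0 y = F 0 [y] := by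
  simp [linearizedExp, decompositions_zero]

theorem clubSign_of_degree_one {l : List (ℤ × V)} (h : ∀ p ∈ l, p.1 = 1) : clubSign l = 1 := by
  have : (l.map Prod.fst).sum = l.length := by
    have e : l.map Prod.fst = List.replicate l.length 1 := by
      rw [List.eq_replicate_iff]
      refine ⟨by simp, fun x hx => ?_⟩
      obtain ⟨p, hp, rfl⟩ := List.mem_map.mp hx
      exact h p hp
    rw [e]; simp
  rw [clubSign, this, ← two_mul, Int.negOnePow_two_mul]

/-- Evaluated on group-like elements of degree one, all signs of the insertion sum are trivial. -/
theorem insertionSum_degree_one [AddCommGroup V] [Module ℂ V] (F : G → List V → W)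
    (m : G → List V → V) (b : G → V) (β : G)
    (L : List G) : insertionSum F m β (L.map fun γ => ((1 : ℤ), b γ)) =
      ∑ q ∈ Finset.HasAntidiagonal.antidiagonal β, ∑ i ∈ Finset.range (L.length + 1),
        ∑ j ∈ Finset.range (L.length - i + 1),
          F q.1 ((L.take i).map b ++ m q.2 (((L.drop i).take j).map b) ::
            (L.drop (i + j)).map b) := by
  simp only [insertionSum, List.length_map]
  refine Finset.sum_congr rfl fun q _ => Finset.sum_congr rfl fun i _ =>
    Finset.sum_congr rfl fun j _ => ?_
  rw [clubSign_of_degree_one (by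
    intro p hp
    rw [← List.map_take] at hp
    obtain ⟨γ, _, rfl⟩ := List.mem_map.mp hp
    rfl), one_smul]
  simp only [← List.map_take, ← List.map_drop, List.map_map, Function.comp_def]

theorem linearizedExp_apply_zero [AddCommGroup V] [Module ℂ V] [Module ℂ W]
    (F : MultilinearFamily G V W) (b : G → V) (γ : G) : linearizedExp F b γ 0 = 0 :=
  Finset.sum_eq_zero fun _ _ => Finset.sum_eq_zero fun _ _ => F.eq_zero_of_zero _ _ _

theorem exists_append_of_le_length {α : Type*} {L : List α} {i : ℕ} (hi : i ≤ L.length) :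
    ∃ L₁ L₂, L = L₁ ++ L₂ ∧ L₁.length = i :=
  ⟨L.take i, L.drop i, (List.take_append_drop i L).symm, List.length_take_of_le hi⟩

theorem drop_length_add_length {α : Type*} (L₁ M L₂ : List α) :
    (L₁ ++ (M ++ L₂)).drop (L₁.length + M.length) = L₂ := by
  rw [← List.drop_drop, List.drop_left, List.drop_left]

/-- The insertion sum `∑ F(id ⊗ m ⊗ id)` evaluated on the group-like element of `b` is the
linearization of `F` at `b` evaluated on `∑ m(b, …, b)`. -/
theorem sum_insertionSum [AddCommGroup V] [Module ℂ V] [Module ℂ W]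
    (F : MultilinearFamily G V W) (m : G → List V → V) (b : G → V) (β : G) :
    ∑ s ∈ decompositions β, insertionSum F m s.1 (s.2.map fun γ => ((1 : ℤ), b γ)) =
      ∑ q ∈ Finset.HasAntidiagonal.antidiagonal β, linearizedExp F b q.1 (evalExp m b q.2) := by
  simp only [insertionSum_degree_one, linearizedExp, evalExp, F.map_sum]
  simp only [Finset.sum_sigma']
  -- A list with a marked sublist `M` of consecutive entries, the inputs of `m`, corresponds to the
  -- list of its other entries with a marked position, together with `M`.
  refine Finset.sum_bij'
    (fun t _ => ⟨(t.2.1.1 + (t.1.2.take t.2.2.1 ++ t.1.2.drop (t.2.2.1 + t.2.2.2)).sum,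
        t.2.1.2 + ((t.1.2.drop t.2.2.1).take t.2.2.2).sum),
      (t.2.1.1, t.1.2.take t.2.2.1 ++ t.1.2.drop (t.2.2.1 + t.2.2.2)), t.2.2.1,
      (t.2.1.2, (t.1.2.drop t.2.2.1).take t.2.2.2)⟩)
    (fun t _ => ⟨(t.2.1.1 + t.2.2.2.1,
        t.2.1.2.take t.2.2.1 ++ t.2.2.2.2 ++ t.2.1.2.drop t.2.2.1),
      (t.2.1.1, t.2.2.2.1), t.2.2.1, t.2.2.2.2.length⟩) ?_ ?_ ?_ ?_ ?_
  · rintro ⟨⟨β₀, L⟩, ⟨q₁, q₂⟩, i, j⟩ h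
    simp only [Finset.mem_sigma, mem_decompositions, Finset.HasAntidiagonal.mem_antidiagonal,
      Finset.mem_range] at h
    obtain ⟨⟨h0, hβ⟩, hq, hi, hj⟩ := h
    obtain ⟨L₁, L', rfl, rfl⟩ := exists_append_of_le_length (Nat.le_of_lt_succ hi)
    rw [List.length_append, Nat.add_sub_cancel_left] at hj
    obtain ⟨M, L₂, rfl, rfl⟩ := exists_append_of_le_length (Nat.le_of_lt_succ hj)
    simp only [List.mem_append, not_or] at h0
    simp only [Finset.mem_sigma, mem_decompositions, Finset.HasAntidiagonal.mem_antidiagonal,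
      Finset.mem_range, List.take_left, List.drop_left, drop_length_add_length, List.mem_append,
      not_or, List.length_append, List.sum_append]
    refine ⟨?_, ⟨⟨h0.1, h0.2.2⟩, trivial⟩, by omega, h0.2.1, trivial⟩
    rw [← hβ, ← hq]
    simp only [List.sum_append]
    abel
  · rintro ⟨⟨γ, κ⟩, ⟨q₁, L⟩, i, ⟨q₂, M⟩⟩ h
    simp only [Finset.mem_sigma, mem_decompositions, Finset.HasAntidiagonal.mem_antidiagonal,
      Finset.mem_range] at h
    obtain ⟨hβ, ⟨h0, hγ⟩, hi, ⟨h0', hκ⟩⟩ := h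
    obtain ⟨L₁, L₂, rfl, rfl⟩ := exists_append_of_le_length (Nat.le_of_lt_succ hi)
    simp only [List.mem_append, not_or] at h0
    simp only [Finset.mem_sigma, mem_decompositions, Finset.HasAntidiagonal.mem_antidiagonal,
      Finset.mem_range, List.take_left, List.drop_left, List.mem_append, not_or,
      List.length_append, List.sum_append]
    refine ⟨⟨⟨⟨h0.1, h0'⟩, h0.2⟩, ?_⟩, trivial, by omega, by omega⟩
    rw [← hβ, ← hγ, ← hκ]
    simp only [List.sum_append]
    abel
  · rintro ⟨⟨β₀, L⟩, ⟨q₁, q₂⟩, i, j⟩ h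
    simp only [Finset.mem_sigma, mem_decompositions, Finset.HasAntidiagonal.mem_antidiagonal,
      Finset.mem_range] at h
    obtain ⟨⟨h0, hβ⟩, hq, hi, hj⟩ := h
    obtain ⟨L₁, L', rfl, rfl⟩ := exists_append_of_le_length (Nat.le_of_lt_succ hi)
    rw [List.length_append, Nat.add_sub_cancel_left] at hj
    obtain ⟨M, L₂, rfl, rfl⟩ := exists_append_of_le_length (Nat.le_of_lt_succ hj)
    simp only [List.take_left, List.drop_left, drop_length_add_length, List.append_assoc, hq]
  · rintro ⟨⟨γ, κ⟩, ⟨q₁, L⟩, i, ⟨q₂, M⟩⟩ h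
    simp only [Finset.mem_sigma, mem_decompositions, Finset.HasAntidiagonal.mem_antidiagonal,
      Finset.mem_range] at h
    obtain ⟨hβ, ⟨h0, hγ⟩, hi, ⟨h0', hκ⟩⟩ := h
    obtain ⟨L₁, L₂, rfl, rfl⟩ := exists_append_of_le_length (Nat.le_of_lt_succ hi)
    simp only [List.take_left, List.drop_left, drop_length_add_length, List.append_assoc, hγ, hκ]
  · rintro ⟨⟨β₀, L⟩, ⟨q₁, q₂⟩, i, j⟩ h
    simp only [Finset.mem_sigma, mem_decompositions, Finset.HasAntidiagonal.mem_antidiagonal,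
      Finset.mem_range] at h
    obtain ⟨⟨h0, hβ⟩, hq, hi, hj⟩ := h
    obtain ⟨L₁, L', rfl, rfl⟩ := exists_append_of_le_length (Nat.le_of_lt_succ hi)
    rw [List.length_append, Nat.add_sub_cancel_left] at hj
    obtain ⟨M, L₂, rfl, rfl⟩ := exists_append_of_le_length (Nat.le_of_lt_succ hj)
    simp only [List.take_left, List.drop_left, drop_length_add_length]

end EvalExp

/-! ### Composition and evaluation on group-like elements -/

section BlockSum

variable {G : Type v} [GappingMonoid G] {V : Type*} {W : Type*} {W' : Type*}

open Classical in
/-- The lists obtained from a list by choosing an element of `S κ` for each of its entries `κ`. -/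
noncomputable def listChoices {κ ι : Type*} (S : κ → Finset ι) : List κ → Finset (List ι)
  | [] => {[]}
  | k :: K => (S k ×ˢ listChoices S K).image fun q => q.1 :: q.2

theorem mem_listChoices_decompositions {K : List G} {P : List (G × List G)} :
    P ∈ listChoices decompositions K ↔
      (∀ p ∈ P, 0 ∉ p.2) ∧ P.map (fun p => p.1 + p.2.sum) = K := by
  induction K generalizing P with
  | nil =>
    simp only [listChoices, Finset.mem_singleton, List.map_eq_nil_iff]
    exact ⟨fun h => ⟨by simp [h], h⟩, fun h => h.2⟩
  | cons k K ih =>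
    cases P with
    | nil => simp [listChoices]
    | cons p P =>
      simp only [listChoices, Finset.mem_image, Finset.mem_product, Prod.exists, List.cons.injEq,
        mem_decompositions, ih, List.map_cons,
        List.forall_mem_cons]
      constructor
      · rintro ⟨a, L, P, ⟨⟨h1, h2⟩, h3, h4⟩, rfl, rfl⟩
        exact ⟨⟨h1, h3⟩, h2, h4⟩
      · rintro ⟨⟨h1, h3⟩, h2, h4⟩
        exact ⟨p.1, p.2, P, ⟨⟨h1, h2⟩, h3, h4⟩, rfl, rfl⟩

theorem MultilinearFamily.map_list_sum {G : Type*} [AddCommGroup V] [Module ℂ V] [AddCommGroup W]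
    [Module ℂ W] (F : MultilinearFamily G V W) (β : G) {κ ι : Type*} (S : κ → Finset ι)
    (u : ι → V) (l : List V) (K : List κ) :
    F β (l ++ K.map fun k => ∑ p ∈ S k, u p) = ∑ P ∈ listChoices S K, F β (l ++ P.map u) := by
  classical
  induction K generalizing l with
  | nil => simp [listChoices]
  | cons k K ih =>
    rw [listChoices, Finset.sum_image (by
      rintro ⟨p, P⟩ - ⟨p', P'⟩ - h
      exact Prod.ext (List.cons.inj h).1 (List.cons.inj h).2)]
    simp only [List.map_cons, Finset.sum_product, F.map_sum]
    refine Finset.sum_congr rfl fun p _ => ?_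
    simpa using ih (l ++ [u p])

theorem eq_zero_nil_of_add_sum_eq_zero {p : G × List G} (h0 : 0 ∉ p.2) (h : p.1 + p.2.sum = 0) :
    p = (0, []) := by
  simpa [decompositions_zero] using mem_decompositions.mpr ⟨h0, h⟩

theorem finite_blocks (β₀ : G) {L : List G} (hL : 0 ∉ L) :
    {t : G × List (G × List G) | t.1 + (t.2.map Prod.fst).sum = β₀ ∧
      (t.2.map Prod.snd).flatten = L ∧ ∀ p ∈ t.2, p ≠ (0, [])}.Finite := by
  refine ((Finset.finite_toSet (decompositions (β₀ + L.sum))).biUnion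
    (t := fun s => Prod.mk s.1 '' (↑(listChoices decompositions s.2) : Set (List (G × List G))))
    fun s _ => (Finset.finite_toSet _).image _).subset ?_
  rintro ⟨a, P⟩ ⟨h1, h2, h3⟩
  dsimp only at h1 h2 h3
  have h0 : ∀ p ∈ P, 0 ∉ p.2 := fun p hp h => hL <| by
    rw [← h2]
    exact List.mem_flatten.mpr ⟨p.2, List.mem_map_of_mem hp, h⟩
  refine Set.mem_biUnion (x := (a, P.map fun p => p.1 + p.2.sum)) ?_
    ⟨P, mem_listChoices_decompositions.mpr ⟨h0, rfl⟩, rfl⟩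
  rw [Finset.mem_coe, mem_decompositions]
  constructor
  · intro h
    obtain ⟨p, hp, hp0⟩ := List.mem_map.mp h
    exact h3 p hp (eq_zero_nil_of_add_sum_eq_zero (h0 p hp) hp0)
  · dsimp only
    rw [← h1, ← h2, List.sum_flatten, List.sum_map_add, List.map_map]
    simp only [Function.comp_def]
    abel

/-- The ways of cutting a list of nonzero elements into consecutive blocks, together with an
element for each block and one more element such that these add up to `β₀`. The pair of `0` and
an empty block is excluded. -/
noncomputable def blocks (β₀ : G) {L : List G} (hL : 0 ∉ L) : Finset (G × List (G × List G)) :=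
  (finite_blocks β₀ hL).toFinset

theorem mem_blocks {β₀ : G} {L : List G} {hL : 0 ∉ L} {t : G × List (G × List G)} :
    t ∈ blocks β₀ hL ↔ t.1 + (t.2.map Prod.fst).sum = β₀ ∧
      (t.2.map Prod.snd).flatten = L ∧ ∀ p ∈ t.2, p ≠ (0, []) := by
  simp [blocks]

theorem exists_blocks_of_flatten_eq_map {G : Type*} {α : Type*} (e : G → α) :
    ∀ (P : List (G × List α)) (L : List G), (P.map Prod.snd).flatten = L.map e →
      ∃ Q : List (G × List G), (Q.map Prod.snd).flatten = L ∧
        P = Q.map fun p => (p.1, p.2.map e)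
  | [], L, h => by
    refine ⟨[], ?_, rfl⟩
    simpa [eq_comm] using h
  | p :: P, L, h => by
    rw [List.map_cons, List.flatten_cons, eq_comm, List.map_eq_append_iff] at h
    obtain ⟨L₁, L₂, rfl, h1, h2⟩ := h
    obtain ⟨Q, hQ, rfl⟩ := exists_blocks_of_flatten_eq_map e P L₂ h2.symm
    refine ⟨(p.1, L₁) :: Q, by simp [hQ], ?_⟩
    rw [List.map_cons, h1]

theorem blockSum_map [AddCommGroup W] [Module ℂ W] [AddCommGroup W'] [Module ℂ W']
    (m : MultilinearFamily G W W') (g : G → List V → W) (hg : g 0 [] = 0) (e : G → V) (β₀ : G)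
    {L : List G} (hL : 0 ∉ L) : blockSum m g β₀ (L.map e) =
      ∑ t ∈ blocks β₀ hL, m t.1 (t.2.map fun p => g p.1 (p.2.map e)) := by
  classical
  let Ψ : G × List (G × List G) → G × List (G × List V) := fun t =>
    (t.1, t.2.map fun p => (p.1, p.2.map e))
  have hΨ : Set.InjOn Ψ (blocks β₀ hL) := by
    rintro ⟨a, P⟩ hP ⟨a', P'⟩ hP' h
    obtain ⟨-, h1, -⟩ := mem_blocks.mp hP
    obtain ⟨-, h2, -⟩ := mem_blocks.mp hP'
    obtain ⟨rfl, h4⟩ := Prod.ext_iff.mp h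
    have h5 : P.map Prod.fst = P'.map Prod.fst := by
      simpa [Ψ, Function.comp_def] using congrArg (List.map Prod.fst) h4
    have h6 : P.map Prod.snd = P'.map Prod.snd := by
      rw [List.eq_iff_flatten_eq]
      refine ⟨h1.trans h2.symm, ?_⟩
      simpa [Ψ, Function.comp_def] using congrArg (List.map fun p => p.2.length) h4
    refine Prod.ext rfl ?_
    rw [← List.zip_unzip P, ← List.zip_unzip P', List.unzip_eq_map, List.unzip_eq_map, h5, h6]
  have key : ∑ t ∈ blocks β₀ hL, m t.1 (t.2.map fun p => g p.1 (p.2.map e)) =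
      ∑ s ∈ (blocks β₀ hL).image Ψ, m s.1 (s.2.map fun q => g q.1 q.2) := by
    rw [Finset.sum_image hΨ]
    simp [Ψ, Function.comp_def]
  rw [key]
  refine finsum_mem_eq_sum_of_inter_support_eq
    (s := {s : G × List (G × List V) | s.1 + (s.2.map Prod.fst).sum = β₀ ∧
      (s.2.map Prod.snd).flatten = L.map e}) _ ?_
  ext ⟨a, P⟩
  simp only [Set.mem_inter_iff, Function.mem_support, Finset.mem_coe, Finset.mem_image]
  refine and_congr_left fun hne => ⟨?_, ?_⟩
  · rintro ⟨h1, h2⟩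
    obtain ⟨Q, hQ, rfl⟩ := exists_blocks_of_flatten_eq_map e P L h2
    refine ⟨(a, Q), mem_blocks.mpr ⟨?_, hQ, fun p hp hp0 => hne ?_⟩, rfl⟩
    · simpa [Function.comp_def] using h1
    · refine m.eq_zero_of_mem _ (List.mem_map.mpr ⟨(0, []), ?_, hg⟩)
      exact List.mem_map.mpr ⟨p, hp, by simp [hp0]⟩
  · rintro ⟨⟨a', Q⟩, hQ, h⟩
    obtain ⟨rfl, rfl⟩ := Prod.ext_iff.mp h
    obtain ⟨h1, h2, -⟩ := mem_blocks.mp hQ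
    refine ⟨by simpa [Ψ, Function.comp_def] using h1, ?_⟩
    rw [← h2, List.map_flatten]
    simp [Ψ, Function.comp_def]

/-- Composition of multilinear families corresponds to iterated evaluation on group-like
elements. -/
theorem evalExp_blockSum [AddCommGroup W] [Module ℂ W] [AddCommGroup W'] [Module ℂ W']
    (m : MultilinearFamily G W W') (g : G → List V → W) (hg : g 0 [] = 0) (e : G → V) (β : G) :
    evalExp (blockSum m g) e β = evalExp m (evalExp g e) β := by
  have h1 : evalExp (blockSum m g) e β = ∑ s ∈ (decompositions β).attach,
      ∑ t ∈ blocks s.1.1 (mem_decompositions.mp s.2).1,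
        m t.1 (t.2.map fun p => g p.1 (p.2.map e)) := by
    rw [evalExp, ← Finset.sum_attach]
    exact Finset.sum_congr rfl fun s _ => blockSum_map m g hg e _ _
  have h2 : evalExp m (evalExp g e) β = ∑ s ∈ decompositions β,
      ∑ P ∈ listChoices decompositions s.2, m s.1 (P.map fun p => g p.1 (p.2.map e)) :=
    Finset.sum_congr rfl fun s _ =>
      m.map_list_sum s.1 decompositions (fun p => g p.1 (p.2.map e)) [] s.2
  -- Both sides are sums over the lists of pairs `p` of an element and a block: on the left they are
  -- grouped by the concatenation of the blocks, on the right by the list of weights of the `p`.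
  rw [h1, h2, Finset.sum_sigma', Finset.sum_sigma']
  have zf : ∀ {P : List (G × List G)}, 0 ∉ (P.map Prod.snd).flatten → ∀ p ∈ P, 0 ∉ p.2 :=
    fun hP p hp h => hP (List.mem_flatten.mpr ⟨p.2, List.mem_map_of_mem hp, h⟩)
  have hsum : ∀ P : List (G × List G), (P.map fun p => p.1 + p.2.sum).sum =
      (P.map Prod.fst).sum + (P.map Prod.snd).flatten.sum := by
    intro P
    rw [List.sum_flatten, List.sum_map_add, List.map_map]
    rfl
  refine Finset.sum_bij (fun x _ => ⟨(x.2.1, x.2.2.map fun p => p.1 + p.2.sum), x.2.2⟩)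
    ?_ ?_ ?_ ?_
  · rintro ⟨⟨⟨β₀, L⟩, hs⟩, ⟨a, P⟩⟩ h
    simp only [Finset.mem_sigma, Finset.mem_attach, true_and, mem_blocks] at h
    obtain ⟨rfl, rfl, hne⟩ := h
    obtain ⟨hL, hβ⟩ := mem_decompositions.mp hs
    rw [Finset.mem_sigma, mem_decompositions, mem_listChoices_decompositions]
    refine ⟨⟨fun hmem => ?_, ?_⟩, zf hL, rfl⟩
    · obtain ⟨p, hp, hp0⟩ := List.mem_map.mp hmem
      exact hne p hp (eq_zero_nil_of_add_sum_eq_zero (zf hL p hp) hp0)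
    · dsimp only at hβ ⊢
      rw [hsum, ← hβ, add_assoc]
  · rintro ⟨⟨⟨β₀, L⟩, hs⟩, ⟨a, P⟩⟩ h ⟨⟨⟨β₀', L'⟩, hs'⟩, ⟨a', P'⟩⟩ h' heq
    simp only [Finset.mem_sigma, Finset.mem_attach, true_and, mem_blocks] at h h'
    obtain ⟨rfl, rfl, -⟩ := h
    obtain ⟨rfl, rfl, -⟩ := h'
    simp only [Sigma.mk.injEq, Prod.mk.injEq, heq_eq_eq] at heq
    obtain ⟨⟨rfl, -⟩, rfl⟩ := heq
    rfl
  · rintro ⟨⟨a, K⟩, P⟩ h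
    simp only [Finset.mem_sigma, mem_decompositions, mem_listChoices_decompositions] at h
    obtain ⟨⟨h0, hβ⟩, hP0, rfl⟩ := h
    have hL : 0 ∉ (P.map Prod.snd).flatten := by
      intro hmem
      obtain ⟨M, hM, h0M⟩ := List.mem_flatten.mp hmem
      obtain ⟨p, hp, rfl⟩ := List.mem_map.mp hM
      exact hP0 p hp h0M
    refine ⟨⟨⟨(a + (P.map Prod.fst).sum, (P.map Prod.snd).flatten),
      mem_decompositions.mpr ⟨hL, ?_⟩⟩, (a, P)⟩, ?_, rfl⟩
    · dsimp only
      rw [← hβ, hsum, add_assoc]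
    · refine Finset.mem_sigma.mpr ⟨Finset.mem_attach _ _, mem_blocks.mpr ⟨rfl, rfl, ?_⟩⟩
      rintro p hp rfl
      exact h0 (List.mem_map.mpr ⟨_, hp, by simp⟩)
  · rintro ⟨⟨⟨β₀, L⟩, hs⟩, ⟨a, P⟩⟩ h
    rfl

end BlockSum

/-! ### Deforming cochains and their curvature -/

namespace GappedAInfinity

variable {G : Type v} [GappingMonoid G]

theorem deformedOp_nil (X : GappedAInfinity.{u} G) {b : G → X} (h0 : b 0 = 0) (β : G) :
    X.deformedOp b β [] = evalExp X.m b β := by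
  classical
  have key : evalExp X.m b β = ∑ s ∈ (decompositions β).image fun t => (t.1, t.2, []),
      X.m s.1 (s.2.1.map b ++
        (List.zipWith (fun (y : X) (L : List G) => y :: L.map b) [] s.2.2).flatten) := by
    rw [Finset.sum_image (by
      rintro ⟨a, P⟩ - ⟨a', P'⟩ - h
      simpa using h)]
    simp [evalExp]
  rw [key]
  refine finsum_mem_eq_sum_of_inter_support_eq
    (s := {s : G × List G × List (List G) | s.2.2.length = ([] : List X).length ∧
      s.1 + s.2.1.sum + s.2.2.flatten.sum = β}) _ ?_
  ext ⟨a, L, M⟩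
  simp only [Set.mem_inter_iff, Function.mem_support, Finset.mem_coe, Finset.mem_image,
    Set.mem_ofPred_eq, List.length_nil, List.length_eq_zero_iff]
  refine and_congr_left fun hne => ⟨?_, ?_⟩
  · rintro ⟨rfl, h2⟩
    refine ⟨(a, L), mem_decompositions.mpr ⟨fun h => hne ?_, by simpa using h2⟩, rfl⟩
    exact X.m.eq_zero_of_mem _ (List.mem_append_left _ (List.mem_map.mpr ⟨0, h, h0⟩))
  · rintro ⟨⟨a', L'⟩, h, heq⟩
    simp only [Prod.mk.injEq] at heq
    obtain ⟨rfl, rfl, rfl⟩ := heq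
    simpa using (mem_decompositions.mp h).2

theorem isHomogeneousList_map {G V : Type*} [AddCommGroup V] [Module ℂ V]
    {gr : ℤ → Submodule ℂ V} {b : G → V} (hb : ∀ γ, b γ ∈ gr 1) (L : List G) :
    IsHomogeneousList gr (L.map fun γ => ((1 : ℤ), b γ)) := by
  intro p hp
  obtain ⟨γ, -, rfl⟩ := List.mem_map.mp hp
  exact hb γ

theorem evalExp_mem {V W : Type*} [AddCommGroup V] [Module ℂ V] [AddCommGroup W] [Module ℂ W]
    {grV : ℤ → Submodule ℂ V} {grW : ℤ → Submodule ℂ W} {F : G → List V → W} {e : ℤ}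
    (hF : HasDegree grV grW F e) {b : G → V} (hb : ∀ γ, b γ ∈ grV 1) (β : G) :
    evalExp F b β ∈ grW e := by
  refine Submodule.sum_mem _ fun s _ => ?_
  have h := hF s.1 _ (isHomogeneousList_map hb s.2)
  simpa [Function.comp_def] using h

/-- The Bianchi identity: the curvature of a deformation is closed for the deformed
differential. -/
theorem sum_linearizedExp_curvature (X : GappedAInfinity.{u} G) {b : G → X}
    (hb : ∀ γ, b γ ∈ X.gr 1) (β : G) :
    ∑ q ∈ Finset.HasAntidiagonal.antidiagonal β,
      linearizedExp X.m b q.1 (evalExp X.m b q.2) = 0 := by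
  rw [← sum_insertionSum]
  exact Finset.sum_eq_zero fun s _ => X.relation _ _ (isHomogeneousList_map hb _)

/-- The first obstruction to the vanishing of the curvature is a cocycle. -/
theorem m_evalExp_eq_zero (X : GappedAInfinity.{u} G) {b : G → X} (hb : ∀ γ, b γ ∈ X.gr 1)
    {β : G} (h : ∀ γ, energy γ < energy β → evalExp X.m b γ = 0) :
    X.m 0 [evalExp X.m b β] = 0 := by
  have h1 := X.sum_linearizedExp_curvature hb β
  rw [Finset.sum_eq_single (0, β)] at h1
  · rwa [linearizedExp_zero] at h1
  · rintro ⟨γ, κ⟩ hq hne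
    obtain rfl : γ + κ = β := by simpa using hq
    have hγ : γ ≠ 0 := by
      rintro rfl
      simp at hne
    rw [h κ (energy_lt_add_left hγ), linearizedExp_apply_zero]
  · intro h2
    simp at h2

/-- Homomorphisms push forward solutions of the Maurer–Cartan equation. -/
theorem Hom.evalExp_eq_zero {X : GappedAInfinity.{u} G} {Y : GappedAInfinity.{w} G} (g : Hom X Y)
    {e : G → X} (he : ∀ γ, e γ ∈ X.gr 1) (h : ∀ γ, evalExp X.m e γ = 0) (β : G) :
    evalExp Y.m (evalExp g.f e) β = 0 := by
  rw [← evalExp_blockSum Y.m g.f g.zero]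
  calc evalExp (blockSum Y.m g.f) e β
      = ∑ s ∈ decompositions β, insertionSum g.f X.m s.1 (s.2.map fun γ => ((1 : ℤ), e γ)) := by
        refine Finset.sum_congr rfl fun s _ => ?_
        rw [g.relation _ _ (isHomogeneousList_map he _)]
        simp [Function.comp_def]
    _ = 0 := by
        rw [sum_insertionSum]
        refine Finset.sum_eq_zero fun q _ => ?_
        rw [h, linearizedExp_apply_zero]

/-- In an anticommutative differential graded algebra the quadratic terms of the curvature cancel
in pairs, so every family of cocycles of degree one solves the Maurer–Cartan equation. -/
theorem IsAnticommutativeDGA.evalExp_eq_zero {X : GappedAInfinity.{u} G}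
    (hX : X.IsAnticommutativeDGA) {e : G → X} (he : ∀ γ, e γ ∈ X.gr 1)
    (hd : ∀ γ, X.m 0 [e γ] = 0) (β : G) : evalExp X.m e β = 0 := by
  have hterm : ∀ s : G × List G, X.m s.1 (s.2.reverse.map e) = -X.m s.1 (s.2.map e) := by
    rintro ⟨a, L⟩
    match L with
    | [] => simp [hX.vanish]
    | [γ] =>
      have : X.m a [e γ] = 0 := by
        by_cases ha : a = 0
        · rw [ha, hd]
        · exact hX.differential a _ ha
      simp [this]
    | [γ, κ] =>
      have h4 : Int.negOnePow ((1 + 1) * (1 + 1)) = 1 := by decide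
      have h5 := hX.anticomm a 1 1 (e κ) (e γ) (he κ) (he γ)
      rw [h4, one_smul] at h5
      exact h5
    | γ :: κ :: ν :: r => rw [hX.vanish, hX.vanish, neg_zero] <;> simp
  have hsum : evalExp X.m e β = ∑ s ∈ decompositions β, X.m s.1 (s.2.reverse.map e) := by
    refine Finset.sum_nbij' (fun s => (s.1, s.2.reverse)) (fun s => (s.1, s.2.reverse))
      ?_ ?_ ?_ ?_ ?_ <;> simp [mem_decompositions, List.sum_reverse]
  simp only [hterm, Finset.sum_neg_distrib] at hsum
  have h2 : (2 : ℂ) • evalExp X.m e β = 0 := by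
    rw [two_smul]
    exact eq_neg_iff_add_eq_zero.mp hsum
  exact (smul_eq_zero.mp h2).resolve_left two_ne_zero

/-! ### The lowest-energy part of a homotopy -/

theorem blocks_eq_nil {α : Type*} {P : List (G × List α)} (h0 : (P.map Prod.fst).sum = 0)
    (hP : (P.map Prod.snd).flatten = []) (hne : ∀ p ∈ P, p ≠ (0, [])) : P = [] := by
  cases P with
  | nil => rfl
  | cons p Q =>
    rw [List.map_cons, List.sum_cons] at h0
    rw [List.map_cons, List.flatten_cons, List.append_eq_nil_iff] at hP
    exact absurd (Prod.ext (eq_zero_of_add_eq_zero h0).1 hP.1) (hne p List.mem_cons_self)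

theorem blocks_eq_singleton {α : Type*} {P : List (G × List α)} {x : α}
    (h0 : (P.map Prod.fst).sum = 0) (hP : (P.map Prod.snd).flatten = [x])
    (hne : ∀ p ∈ P, p ≠ (0, [])) : P = [(0, [x])] := by
  cases P with
  | nil => simp at hP
  | cons p Q =>
    rw [List.map_cons, List.sum_cons] at h0
    obtain ⟨h1, h2⟩ := eq_zero_of_add_eq_zero h0
    rw [List.map_cons, List.flatten_cons, List.append_eq_singleton_iff] at hP
    rcases hP with ⟨h3, -⟩ | ⟨h3, h4⟩
    · exact absurd (Prod.ext h1 h3) (hne p List.mem_cons_self)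
    · rw [blocks_eq_nil h2 h4 fun q hq => hne q (List.mem_cons_of_mem _ hq)]
      exact congrArg (· :: []) (Prod.ext h1 h3)

section LowestEnergy

variable {V W W' : Type*} [AddCommGroup W] [Module ℂ W] [AddCommGroup W'] [Module ℂ W']

theorem blockSum_zero_nil [Zero V] (m : MultilinearFamily G W W') {f : G → List V → W}
    (hf : f 0 [] = 0) : blockSum m f 0 [] = m 0 [] := by
  simpa only [evalExp_zero] using evalExp_blockSum m f hf (fun _ => (0 : V)) 0

/-- Only one block contributes to a composite `(m ∘ f)^{1,0}`. -/
theorem blockSum_zero_singleton (m : MultilinearFamily G W W') {f : G → List V → W}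
    (hf : f 0 [] = 0) (x : V) : blockSum m f 0 [x] = m 0 [f 0 [x]] := by
  have key : m 0 [f 0 [x]] = ∑ s ∈ ({(0, [(0, [x])])} : Finset (G × List (G × List V))),
      m s.1 (s.2.map fun q => f q.1 q.2) := by simp
  rw [key]
  refine finsum_mem_eq_sum_of_inter_support_eq
    (s := {s : G × List (G × List V) | s.1 + (s.2.map Prod.fst).sum = 0 ∧
      (s.2.map Prod.snd).flatten = [x]}) _ ?_
  ext ⟨a, P⟩
  simp only [Set.mem_inter_iff, Function.mem_support, Finset.coe_singleton,
    Set.mem_singleton_iff, Set.mem_ofPred_eq]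
  refine and_congr_left fun hne => ⟨?_, ?_⟩
  · rintro ⟨h1, h2⟩
    obtain ⟨rfl, h3⟩ := eq_zero_of_add_eq_zero h1
    rw [blocks_eq_singleton h3 h2]
    rintro p hp rfl
    exact hne (m.eq_zero_of_mem _ (List.mem_map.mpr ⟨_, hp, hf⟩))
  · rintro h
    simp only [Prod.mk.injEq] at h
    obtain ⟨rfl, rfl⟩ := h
    simp

/-- Only one term contributes to the component `(1, 0)` of a homotopy sum. -/
theorem homotopySum_zero_singleton (m : MultilinearFamily G W W') {F h F' : G → List V → W}
    (hF : F 0 [] = 0) (hh : h 0 [] = 0) (hF' : F' 0 [] = 0) (p : ℤ × V) :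
    homotopySum m F h F' 0 [p] = m 0 [h 0 [p.2]] := by
  have key : m 0 [h 0 [p.2]] = ∑ s ∈ ({(0, [], (0, [p]), [])} :
      Finset (G × List (G × List (ℤ × V)) × (G × List (ℤ × V)) × List (G × List (ℤ × V)))),
      clubSign (s.2.1.map Prod.snd).flatten •
        m s.1 (s.2.1.map (fun q => F q.1 (q.2.map Prod.snd)) ++
          h s.2.2.1.1 (s.2.2.1.2.map Prod.snd) ::
            s.2.2.2.map (fun q => F' q.1 (q.2.map Prod.snd))) := by
    simp [clubSign]
  rw [key]
  refine finsum_mem_eq_sum_of_inter_support_eq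
    (s := {s : G × List (G × List (ℤ × V)) × (G × List (ℤ × V)) × List (G × List (ℤ × V)) |
      s.1 + (s.2.1.map Prod.fst).sum + s.2.2.1.1 + (s.2.2.2.map Prod.fst).sum = 0 ∧
      (s.2.1.map Prod.snd).flatten ++ s.2.2.1.2 ++ (s.2.2.2.map Prod.snd).flatten = [p]}) _ ?_
  ext ⟨a, P, ⟨c, M⟩, Q⟩
  simp only [Set.mem_inter_iff, Function.mem_support, Finset.coe_singleton,
    Set.mem_singleton_iff, Set.mem_ofPred_eq]
  refine and_congr_left fun hne => ⟨?_, ?_⟩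
  · rintro ⟨h1, h2⟩
    obtain ⟨h3, hQ0⟩ := eq_zero_of_add_eq_zero h1
    obtain ⟨h4, rfl⟩ := eq_zero_of_add_eq_zero h3
    obtain ⟨rfl, hP0⟩ := eq_zero_of_add_eq_zero h4
    have hne' := right_ne_zero_of_smul hne
    have hP : ∀ q ∈ P, q ≠ (0, []) := by
      rintro q hq rfl
      exact hne' (m.eq_zero_of_mem _
        (List.mem_append_left _ (List.mem_map.mpr ⟨_, hq, hF⟩)))
    have hQ : ∀ q ∈ Q, q ≠ (0, []) := by
      rintro q hq rfl
      exact hne' (m.eq_zero_of_mem _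
        (List.mem_append_right _ (List.mem_cons_of_mem _ (List.mem_map.mpr ⟨_, hq, hF'⟩))))
    have hM : M ≠ [] := by
      rintro rfl
      exact hne' (m.eq_zero_of_mem _ (List.mem_append_right _ (List.mem_cons.mpr (Or.inl hh.symm))))
    simp only [List.append_eq_singleton_iff, List.append_eq_nil_iff, hM, and_false, false_and,
      false_or, or_false] at h2
    obtain ⟨⟨hP', rfl⟩, hQ'⟩ := h2
    rw [blocks_eq_nil hP0 hP' hP, blocks_eq_nil hQ0 hQ' hQ]
  · rintro h
    simp only [Prod.mk.injEq] at h
    obtain ⟨rfl, rfl, ⟨rfl, rfl⟩, rfl⟩ := h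
    simp

end LowestEnergy

/-- The linear part of a homotopy of `g ∘ f` to the identity is a chain homotopy. -/
theorem Homotopy.comp_sub_self_of_closed {X : GappedAInfinity.{u} G} {Y : GappedAInfinity.{w} G}
    {g : Hom Y X} {f : Hom X Y}
    (H : Homotopy (X := X) (Y := X) (compFamily g f) identityFamily) {i : ℤ} {x : X}
    (hx : x ∈ X.gr i) (hd : X.m 0 [x] = 0) :
    g.f 0 [f.f 0 [x]] - x = X.m 0 [H.h 0 [x]] := by
  have h := H.relation 0 [(i, x)] (by simpa [IsHomogeneousList] using hx)
  have z0 : H.h 0 [0] = 0 := H.h.eq_zero_of_zero 0 [] []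
  have z1 : H.h 0 [0, x] = 0 := H.h.eq_zero_of_zero 0 [] [x]
  have z2 : H.h 0 [x, 0] = 0 := H.h.eq_zero_of_zero 0 [x] []
  have hins : insertionSum H.h X.m 0 [(i, x)] = 0 := by
    simp [insertionSum, antidiagonal_zero, Finset.sum_range_succ, X.curvature_zero, z0, z1, z2,
      hd]
  have hcomp0 : compFamily g f 0 [] = 0 := (blockSum_zero_nil g.f f.zero).trans g.zero
  have hcomp1 : compFamily g f 0 [x] = g.f 0 [f.f 0 [x]] := blockSum_zero_singleton g.f f.zero x
  have hid : identityFamily (0 : G) [x] = x := if_pos rfl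
  rw [hins, homotopySum_zero_singleton X.m hcomp0 H.zero rfl, add_zero, List.map_singleton, hcomp1,
    hid] at h
  exact h

theorem Hom.m_apply_eq_zero {X : GappedAInfinity.{u} G} {Y : GappedAInfinity.{w} G} (f : Hom X Y)
    {i : ℤ} {x : X} (hx : x ∈ X.gr i) (hd : X.m 0 [x] = 0) : Y.m 0 [f.f 0 [x]] = 0 := by
  have h := f.relation 0 [(i, x)] (by simpa [IsHomogeneousList] using hx)
  have z0 : f.f 0 [0] = 0 := f.f.eq_zero_of_zero 0 [] []
  have z1 : f.f 0 [0, x] = 0 := f.f.eq_zero_of_zero 0 [] [x]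
  have z2 : f.f 0 [x, 0] = 0 := f.f.eq_zero_of_zero 0 [x] []
  rw [List.map_singleton, blockSum_zero_singleton Y.m f.zero] at h
  rw [← h]
  simp [insertionSum, antidiagonal_zero, Finset.sum_range_succ, X.curvature_zero, z0, z1, z2, hd]

theorem Hom.apply_mem {X : GappedAInfinity.{u} G} {Y : GappedAInfinity.{w} G} (f : Hom X Y)
    {i : ℤ} {x : X} (hx : x ∈ X.gr i) : f.f 0 [x] ∈ Y.gr i := by
  have h := f.degree_f 0 [(i, x)] (by simpa [IsHomogeneousList] using hx)
  simpa using h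

theorem Homotopy.apply_mem {X : GappedAInfinity.{u} G} {Y : GappedAInfinity.{w} G}
    {F F' : G → List X → Y} (H : Homotopy F F') {i j : ℤ} (hij : j + 1 = i) {x : X}
    (hx : x ∈ X.gr i) : H.h 0 [x] ∈ Y.gr j := by
  have h := H.degree_h 0 [(i, x)] (by simpa [IsHomogeneousList] using hx)
  subst hij
  simpa using h

/-! ### Primitives from the connecting map -/

namespace StrongIdeal

variable {B : GappedAInfinity.{u} G} (A : StrongIdeal B)

/-- If the connecting map is onto, then `H²(A̲) → H²(B̲)` vanishes by the long exact sequence, so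
that cocycles of `A̲` of degree two are coboundaries in `B̲`. -/
theorem exists_primitive (hδ : Function.Surjective A.connectingMap.hom) {o : B}
    (hoA : o ∈ A.carrier) (ho : o ∈ B.gr 2) (hd : B.m 0 [o] = 0) :
    ∃ b ∈ B.gr 1, B.m 0 [b] = o := by
  let S := A.shortComplex
  have hepi : Epi A.connectingMap := (ModuleCat.epi_iff_surjective _).mpr hδ
  have hzero : HomologicalComplex.homologyMap S.f 2 = 0 :=
    Limits.zero_of_epi_comp A.connectingMap (A.shortExact.δ_comp 1 2 rfl)
  have hcomp : S.X₁.iCycles 2 ≫ S.f.f 2 ≫ S.X₂.pOpcycles 2 = 0 := by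
    rw [← HomologicalComplex.cyclesMap_i_assoc, ← HomologicalComplex.homology_π_ι,
      ← HomologicalComplex.homologyπ_naturality_assoc, hzero, Limits.zero_comp, Limits.comp_zero]
  let x : (S.X₁.sc 2).X₂ := (⟨⟨o, hoA⟩, ho⟩ : A.algebra.gr 2)
  have hdx : ∀ j, S.X₁.d 2 j x = 0 := by
    intro j
    by_cases hj : (2 : ℤ) + 1 = j
    · have h : S.X₁.d 2 j = ModuleCat.ofHom (A.algebra.lowestDifferential.restrict
          fun _ hy => A.algebra.m_single_mem hj hy) := dif_pos hj
      rw [h]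
      exact Subtype.ext (Subtype.ext hd)
    · have h : S.X₁.d 2 j = 0 := S.X₁.shape 2 j hj
      rw [h]
      rfl
  have hx : (S.X₁.sc 2).g x = 0 := hdx _
  let z : (S.X₁.sc 2).cycles := (S.X₁.sc 2).moduleCatCyclesIso.inv ⟨x, hx⟩
  have hz : (S.X₁.sc 2).iCycles z = x :=
    (S.X₁.sc 2).moduleCatCyclesIso_inv_iCycles_apply ⟨x, hx⟩
  have hp : (S.X₂.sc 2).pOpcycles (S.f.f 2 x) = 0 := by
    rw [← hz]
    exact ConcreteCategory.congr_hom hcomp z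
  obtain ⟨b, hb⟩ := ((S.X₂.sc 2).moduleCat_pOpcycles_eq_zero_iff _).mp hp
  have key : ∀ (j : ℤ) (c : B.gr j), B.underline.d j 2 c = S.f.f 2 x →
      ∃ b ∈ B.gr 1, B.m 0 [b] = o := by
    intro j c hc
    by_cases hj : j + 1 = 2
    · have h : B.underline.d j 2 = ModuleCat.ofHom (B.lowestDifferential.restrict
          fun _ hy => B.m_single_mem hj hy) := dif_pos hj
      rw [h] at hc
      obtain rfl : j = 1 := by omega
      exact ⟨c, c.2, congrArg (fun y : B.gr 2 => (y : B)) hc⟩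
    · have h : B.underline.d j 2 = 0 := B.underline.shape j 2 hj
      rw [h] at hc
      have h0 : (0 : B) = o := congrArg (fun y : B.gr 2 => (y : B)) hc
      refine ⟨0, Submodule.zero_mem _, ?_⟩
      rw [← h0]
      exact B.m.eq_zero_of_zero 0 [] []
  exact key _ b hb

/-- The projection `B̲ → B̲ / A̲` is a strict homomorphism. -/
theorem projectionLinear_evalExp (b : G → B) (β : G) :
    A.projectionLinear (evalExp B.m b β) =
      evalExp A.quotient.m (fun γ => A.projectionLinear (b γ)) β := by
  rw [evalExp, evalExp, _root_.map_sum]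
  refine Finset.sum_congr rfl fun s _ => ?_
  have h := A.mkQ_m s.1 (s.2.map b)
  rw [List.map_map] at h
  exact h.symm

theorem projectionLinear_m (x : B) :
    A.projectionLinear (B.m 0 [x]) = A.quotient.m 0 [A.projectionLinear x] :=
  (A.mkQ_m 0 [x]).symm

theorem projectionLinear_eq_zero {x : B} : A.projectionLinear x = 0 ↔ x ∈ A.carrier :=
  Submodule.Quotient.mk_eq_zero _

/-- Correcting the linear term: with `C = B / A`, if `g ∘ f : C → C` is homotopic to the identity
then a cocycle `o` of degree two in the ideal has a primitive whose image in `C` has the form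
`g(f(c))` for a cocycle `c`. -/
theorem exists_primitive_of_homotopy (hδ : Function.Surjective A.connectingMap.hom)
    {D : GappedAInfinity.{w} G} {f : Hom A.quotient D} {g : Hom D A.quotient}
    (H : Homotopy (X := A.quotient) (Y := A.quotient) (compFamily g f) identityFamily) {o : B}
    (hoA : o ∈ A.carrier) (ho : o ∈ B.gr 2) (hd : B.m 0 [o] = 0) :
    ∃ x ∈ D.gr 1, D.m 0 [x] = 0 ∧ ∃ b ∈ B.gr 1, B.m 0 [b] = o ∧
      A.projectionLinear b = g.f 0 [x] := by
  obtain ⟨b, hb, rfl⟩ := A.exists_primitive hδ hoA ho hd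
  have hc : A.projectionLinear b ∈ A.quotient.gr 1 := ⟨b, hb, rfl⟩
  have hdc : A.quotient.m 0 [A.projectionLinear b] = 0 := by
    rw [← projectionLinear_m, projectionLinear_eq_zero]
    exact hoA
  obtain ⟨y, hy, hyc⟩ := H.apply_mem (show (0 : ℤ) + 1 = 1 by norm_num) hc
  have hyc' : A.projectionLinear y = H.h 0 [A.projectionLinear b] := hyc
  refine ⟨f.f 0 [A.projectionLinear b], f.apply_mem hc, f.m_apply_eq_zero hc hdc,
    b + B.m 0 [y], Submodule.add_mem _ hb (B.m_single_mem (by norm_num) hy), ?_, ?_⟩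
  · have h := B.m.map_add' 0 [] b (B.m 0 [y]) []
    simp only [List.nil_append] at h
    rw [h, B.m_m_single hy, add_zero]
  · rw [_root_.map_add, projectionLinear_m, hyc', ← H.comp_sub_self_of_closed hc hdc,
      add_sub_cancel]

end StrongIdeal

end GappedAInfinity

/-! ### Construction of the bounding cochain -/

/-- The linear map `F^{1,β}`. -/
def MultilinearFamily.linearPart {G V W : Type*} [AddCommGroup V] [Module ℂ V] [AddCommGroup W]
    [Module ℂ W] (F : MultilinearFamily G V W) (β : G) : V →ₗ[ℂ] W where
  toFun x := F β [x]
  map_add' x y := F.map_add' β [] x y []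
  map_smul' c x := F.map_smul' β [] c x []

namespace GappedAInfinity.StrongIdeal

variable {G : Type v} [GappingMonoid G] {B : GappedAInfinity.{u} G} (A : StrongIdeal B)

/-- The conditions at `β` on a pair `u = (e, b)` of a family `e` in `D` and a family `b` in `B`,
for a homomorphism `g` from `D` to the quotient `C = B / A`: the component `e_β` is a cocycle of
degree one, `b_β` is a lift of degree one of the component of the push-forward `g_* e`, and the
curvature of the deformation by `b` vanishes. -/
structure IsPartialSolution {D : GappedAInfinity.{w} G} (g : Hom D A.quotient) (β : G)
    (u : G → D × B) : Prop where
  zero : β = 0 → u β = 0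
  mem_fst : (u β).1 ∈ D.gr 1
  closed : D.m 0 [(u β).1] = 0
  mem_snd : (u β).2 ∈ B.gr 1
  lift : A.projectionLinear (u β).2 = evalExp g.f (fun γ => (u γ).1) β
  curvature : evalExp B.m (fun γ => (u γ).2) β = 0

theorem IsPartialSolution.congr {D : GappedAInfinity.{w} G} {g : Hom D A.quotient} {β : G}
    {u u' : G → D × B} (hβ : u β = u' β) (h : ∀ γ, energy γ < energy β → u γ = u' γ)
    (hu : A.IsPartialSolution g β u) : A.IsPartialSolution g β u' where
  zero := hβ ▸ hu.zero
  mem_fst := hβ ▸ hu.mem_fst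
  closed := hβ ▸ hu.closed
  mem_snd := hβ ▸ hu.mem_snd
  lift := by
    rw [← hβ, hu.lift]
    exact evalExp_congr (congrArg Prod.fst hβ) fun γ hγ => congrArg Prod.fst (h γ hγ)
  curvature := by
    rw [← hu.curvature]
    exact evalExp_congr (congrArg Prod.snd hβ.symm) fun γ hγ => congrArg Prod.snd (h γ hγ).symm

/-- The inductive step. Over the cocycles of smaller energy the push-forward `g_* e` solves the
Maurer–Cartan equation of `B / A`, so the first nonzero curvature term of a lift of it lies in `A`
and is a cocycle; changing `e_β` by a cocycle removes it. -/
theorem exists_isPartialSolution (hδ : Function.Surjective A.connectingMap.hom)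
    {D : GappedAInfinity.{w} G} (hD : D.IsAnticommutativeDGA) {f : Hom A.quotient D}
    {g : Hom D A.quotient}
    (H : Homotopy (X := A.quotient) (Y := A.quotient) (compFamily g f) identityFamily) (β : G)
    (u : G → D × B) (hu : ∀ γ, energy γ < energy β → A.IsPartialSolution g γ u) :
    ∃ u' : G → D × B, (∀ γ, energy γ < energy β → u' γ = u γ) ∧ A.IsPartialSolution g β u' := by
  classical
  by_cases hβ : β = 0
  · subst hβ
    refine ⟨fun _ => 0, fun γ hγ => ?_, fun _ => rfl, Submodule.zero_mem _,
      D.m.eq_zero_of_zero 0 [] [], Submodule.zero_mem _, ?_, ?_⟩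
    · rw [map_zero] at hγ
      exact absurd hγ not_lt_zero
    · rw [evalExp_zero, g.zero]
      exact _root_.map_zero A.projectionLinear
    · rw [evalExp_zero, B.curvature_zero]
  -- The family `e` is cut off at `β`: all its components are cocycles, also those not yet chosen.
  let e : G → D := fun γ => if energy γ < energy β then (u γ).1 else 0
  have he_lt : ∀ γ, energy γ < energy β → e γ = (u γ).1 := fun γ hγ => if_pos hγ
  have heβ : e β = 0 := if_neg (lt_irrefl _)
  have he : ∀ γ, e γ ∈ D.gr 1 := fun γ => by
    by_cases hγ : energy γ < energy β
    · rw [he_lt γ hγ]; exact (hu γ hγ).mem_fst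
    · rw [show e γ = 0 from if_neg hγ]; exact Submodule.zero_mem _
  have hde : ∀ γ, D.m 0 [e γ] = 0 := fun γ => by
    by_cases hγ : energy γ < energy β
    · rw [he_lt γ hγ]; exact (hu γ hγ).closed
    · rw [show e γ = 0 from if_neg hγ]; exact D.m.eq_zero_of_zero 0 [] []
  have hc : ∀ γ, evalExp g.f e γ ∈ A.quotient.gr 1 := evalExp_mem g.degree_f he
  choose b' hb' hb'c using hc
  let b : G → B := fun γ => if energy γ < energy β then (u γ).2 else b' γ
  have hb_lt : ∀ γ, energy γ < energy β → b γ = (u γ).2 := fun γ hγ => if_pos hγ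
  have hb : ∀ γ, b γ ∈ B.gr 1 := fun γ => by
    by_cases hγ : energy γ < energy β
    · rw [hb_lt γ hγ]; exact (hu γ hγ).mem_snd
    · rw [show b γ = b' γ from if_neg hγ]; exact hb' γ
  have hbe : ∀ γ, A.projectionLinear (b γ) = evalExp g.f e γ := fun γ => by
    by_cases hγ : energy γ < energy β
    · rw [hb_lt γ hγ, (hu γ hγ).lift]
      exact evalExp_congr (he_lt γ hγ).symm fun κ hκ => (he_lt κ (hκ.trans hγ)).symm
    · rw [show b γ = b' γ from if_neg hγ]; exact hb'c γ
  have hcurv : ∀ γ, energy γ < energy β → evalExp B.m b γ = 0 := fun γ hγ => by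
    rw [← (hu γ hγ).curvature]
    exact evalExp_congr (hb_lt γ hγ) fun κ hκ => hb_lt κ (hκ.trans hγ)
  have hoA : evalExp B.m b β ∈ A.carrier := by
    rw [← projectionLinear_eq_zero, projectionLinear_evalExp]
    simp only [hbe]
    exact g.evalExp_eq_zero he (hD.evalExp_eq_zero he hde) β
  obtain ⟨x, hx, hdx, y, hy, hdy, hyx⟩ := A.exists_primitive_of_homotopy hδ H hoA
    (evalExp_mem B.degree_m hb β) (B.m_evalExp_eq_zero hb hcurv)
  -- The sign of `-x` matches that of `-y`, since `g^{1,0}(x)` is the image of `y` in `B / A`.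
  let u' : G → D × B := fun γ => if γ = β then (-x, b β - y) else (e γ, b γ)
  have hu'β : u' β = (-x, b β - y) := if_pos rfl
  have hu' : ∀ γ, energy γ < energy β → u' γ = (e γ, b γ) := fun γ hγ =>
    if_neg fun h => hγ.ne (congrArg _ h)
  refine ⟨u', fun γ hγ => ?_, fun h => absurd h hβ, ?_, ?_, ?_, ?_, ?_⟩
  · rw [hu' γ hγ, he_lt γ hγ, hb_lt γ hγ]
  · rw [hu'β]; exact Submodule.neg_mem _ hx
  · rw [hu'β]
    exact ((D.m.linearPart 0).map_neg x).trans (neg_eq_zero.mpr hdx)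
  · rw [hu'β]; exact Submodule.sub_mem _ (hb β) hy
  · have h := evalExp_sub_single (F := g.f) (b := fun γ => (u' γ).1) (b' := e) hβ
      fun γ hγ => by rw [hu' γ hγ]
    have h1 : g.f 0 [-x] = -g.f 0 [x] := (g.f.linearPart 0).map_neg x
    have h2 : g.f 0 [0] = 0 := g.f.eq_zero_of_zero 0 [] []
    rw [hu'β, heβ, h1, h2, ← hbe β, sub_zero, sub_neg_eq_add] at h
    rw [hu'β, _root_.map_sub, hyx, ← h, add_sub_cancel_right]
  · have h := evalExp_sub_single (F := B.m) (b := fun γ => (u' γ).2) (b' := b) hβ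
      fun γ hγ => by rw [hu' γ hγ]
    have h1 : B.m 0 [b β - y] = B.m 0 [b β] - B.m 0 [y] := (B.m.linearPart 0).map_sub (b β) y
    rw [hu'β, h1, hdy, sub_sub_eq_add_sub, sub_left_inj, add_eq_right] at h
    exact h

theorem exists_isBoundingCochain (hδ : Function.Surjective A.connectingMap.hom)
    {D : GappedAInfinity.{w} G} (hD : D.IsAnticommutativeDGA)
    (hC : A.quotient.HomotopyEquivalent D) : ∃ b : G → B, B.IsBoundingCochain b := by
  obtain ⟨f, g, ⟨H⟩, -⟩ := hC
  obtain ⟨u, hu⟩ := exists_forall_of_step (fun β (u : G → D × B) => A.IsPartialSolution g β u)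
    (fun β u u' hβ h hP => IsPartialSolution.congr A hβ h hP)
    (A.exists_isPartialSolution hδ hD H)
  have h0 : (u 0).2 = 0 := congrArg Prod.snd ((hu 0).zero rfl)
  refine ⟨fun γ => (u γ).2, ⟨h0, fun γ => (hu γ).mem_snd⟩, fun γ => ?_⟩
  rw [B.deformedOp_nil h0]
  exact (hu γ).curvature

end GappedAInfinity.StrongIdeal

theorem mainTheorem9 {G : Type v} [GappingMonoid G] (B : GappedAInfinity.{u} G)
    (A : B.StrongIdeal)
    (hC : ∃ C' : GappedAInfinity.{w} G,
      A.quotient.HomotopyEquivalent C' ∧ C'.IsAnticommutativeDGA)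
    (hδ : Function.Surjective A.connectingMap.hom) :
    (∀ lam : ℝ, 0 < lam → ∃ b : G → B, B.IsDeformingCochain b ∧
      ∀ β : G, (GappingMonoid.energy β : ℝ) ≤ lam → B.deformedOp b β [] = 0) ∧
    ∃ b : G → B, B.IsBoundingCochain b := by
  obtain ⟨D, hCD, hD⟩ := hC
  obtain ⟨b, hb⟩ := A.exists_isBoundingCochain hδ hD hCD
  exact ⟨fun _ _ => ⟨b, hb.toIsDeformingCochain, fun β _ => hb.curvature β⟩, b, hb⟩
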